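/- Let $K$ be fixed. For $k=1,\dots,K$ let $F_k$ be a probability distribution on $\mathbb{R}^d$, and let $X_{k,i}$ ($1\le k\le K$, $i\ge 1$) be independent random vectors with $X_{k,i}\sim F_k$. Let $p=p_1+p_2$ and let $M:\mathbb{R}^d\times\mathbb{R}^{p}\to\mathbb{R}$, $(x,\theta)\mapsto M(x;\theta)$ with $\theta=(\phi,\lambda)$, $\phi\in\mathbb{R}^{p_1}$, $\lambda\in\mathbb{R}^{p_2}$. Let $\Theta_k\subset\mathbb{R}^p$ and $\theta_k^*=(\phi^*,\lambda_k^*)$, where $\phi^*$ does not depend on $k$; put $M_k(\theta)=\mathbb{E}M(X_{k,1};\theta)$. All gradients and Hessians are with respect to $\theta$; matrix norms are spectral norms. Assume for every $k$: (0) $M(x;\cdot)$ is convex on $\Theta_k$ for every $x$, and $M(X_{k,1};\theta)$ is integrable for every $\theta\in\Theta_k$. (1) Along the sequence of experiments considered, block $k$ has sample size $n_k$, $N=\sum_k n_k\to\infty$ and $n_k/N\to\gamma_k>0$. (2) $\theta_k^*$ is the unique minimizer of $M_k$ on $\Theta_k$. (3) $\Theta_k$ is compact and convex, and $\theta_k^*$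 is an interior point of it. (4) $M_k$ is twice differentiable at $\theta_k^*$ and $\nabla^2M_k(\theta_k^*)\succeq\rho_- I$ for some $\rho_->0$ independent of $k$. (5) For some $v,v_1\ge 2$ there are constants $R,L,G_0,B_0,\rho>0$ and measurable functions $G,B$ on $\mathbb{R}^d$, all independent of $k$, such that $M(x;\cdot)$ is twice differentiable on $U_k=\{\theta:\|\theta-\theta_k^*\|_2\le\rho\}$ for every $x$; $\mathbb{E}\|\nabla M(X_{k,1};\theta_k^*)\|^{2v_1}\le R^{2v_1}$; $\mathbb{E}\|\nabla^2M(X_{k,1};\theta_k^*)-\nabla^2M_k(\theta_k^*)\|^{2v}\le L^{2v}$; for every $x$ the maps $\theta\mapsto\nabla^2M(x;\theta)$ and $\theta\mapsto\nabla M(x;\theta)\nabla M(x;\theta)^T$ are Lipschitz on $U_k$ with constants $G(x)$ and $B(x)$; and $\mathbb{E}|G(X_{k,1})|^{2v}\le G_0^{2v}$, $\mathbb{E}|B(X_{k,1})|^{2v}\le B_0^{2v}$. Let $(\hat\phi_k,\hat\lambda_k)$ be a random vector that almost surely minimizes $\sum_{i=1}^{n_k}M(X_{k,i};\theta)$ over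 $\theta\in\Theta_k$, and let $\hat\phi^{SaC}=N^{-1}\sum_k n_k\hat\phi_k$. Let $(\hat\phi_{full},\hat\lambda_{1,full},\dots,\hat\lambda_{K,full})$ be a random vector that almost surely minimizes $\sum_{k}\sum_{i=1}^{n_k}M(X_{k,i};\phi,\lambda_k)$ over all $(\phi,\lambda_1,\dots,\lambda_K)$ with $(\phi,\lambda_k)\in\Theta_k$ for every $k$. Write $$\mathbb{E}\nabla^2M(X_{k,1};\theta_k^*)=\begin{pmatrix}\Psi_\phi^\phi&\Psi_\phi^\lambda\\ \Psi_\lambda^\phi&\Psi_\lambda^\lambda\end{pmatrix},\qquad J_k=J_{\phi|\lambda}(\theta_k^*)=\Psi_\phi^\phi-\Psi_\phi^\lambda(\Psi_\lambda^\lambda)^{-1}\Psi_\lambda^\phi,$$ $$\Sigma_k=\mathrm{Var}\Big\{\partial_\phi M(X_{k,1};\theta_k^*)-\Psi_\phi^\lambda(\Psi_\lambda^\lambda)^{-1}\partial_\lambda M(X_{k,1};\theta_k^*)\Big\}.$$ Then $\Psi_\lambda^\lambda$ and $J_k$ are positive definite for every $k$, and $$\sqrt N(\hat\phi^{SaC}-\phi^*)\xrightarrow{d}\mathcal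 N\Big(0,\sum_k\gamma_kJ_k^{-1}\Sigma_kJ_k^{-1}\Big),$$ $$\sqrt N(\hat\phi_{full}-\phi^*)\xrightarrow{d}\mathcal N\Big(0,\big(\sum_k\gamma_kJ_k\big)^{-1}\big(\sum_k\gamma_k\Sigma_k\big)\big(\sum_k\gamma_kJ_k\big)^{-1}\Big).$$ Moreover, the full-sample estimator need not be more efficient than the SaC estimator: there are $d,p_1,p_2,K$ with $p_2\ge 1$, and $M,F_k,\Theta_k,\theta_k^*,n_k,\gamma_k$ satisfying (0)-(5), for which $$\big(\sum_k\gamma_kJ_k\big)^{-1}\big(\sum_k\gamma_k\Sigma_k\big)\big(\sum_k\gamma_kJ_k\big)^{-1}\preceq\sum_k\gamma_kJ_k^{-1}\Sigma_kJ_k^{-1}$$ fails, where $A\preceq B$ means that $B-A$ is positive semidefinite. -/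

import Mathlib

open MeasureTheory ProbabilityTheory Filter Topology
open scoped Matrix.Norms.L2Operator

namespace SaC

/-- The space `ℝ^d` of observations. -/
abbrev Obs (d : ℕ) : Type := EuclideanSpace ℝ (Fin d)

/-- The space `ℝ^{p₁+p₂}` of block parameters `θ_k = (φ, λ_k)` with the Euclidean norm; the
coordinates of `φ` are indexed by `Sum.inl`, those of `λ_k` by `Sum.inr`. -/
abbrev Param (p₁ p₂ : ℕ) : Type := EuclideanSpace ℝ (Fin p₁ ⊕ Fin p₂)

noncomputable section

variable {d p₁ p₂ K : ℕ}

/-- The block parameter `(φ, λ)`. -/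
def join (φ : EuclideanSpace ℝ (Fin p₁)) (l : EuclideanSpace ℝ (Fin p₂)) : Param p₁ p₂ :=
  WithLp.toLp 2 (Sum.elim φ l)

/-- The component `φ` of `θ = (φ, λ)`. -/
def common (θ : Param p₁ p₂) : EuclideanSpace ℝ (Fin p₁) :=
  WithLp.toLp 2 (fun a => θ (Sum.inl a))

/-! ### Derivatives -/

/-- `f` is twice differentiable at `θ`. -/
def TwiceDifferentiableAt (f : Param p₁ p₂ → ℝ) (θ : Param p₁ p₂) : Prop :=
  (∀ᶠ η in 𝓝 θ, DifferentiableAt ℝ f η) ∧ DifferentiableAt ℝ (gradient f) θ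

/-- The Hessian matrix `∇²f(θ)`, the Jacobian matrix of the gradient. -/
def hess (f : Param p₁ p₂ → ℝ) (θ : Param p₁ p₂) :
    Matrix (Fin p₁ ⊕ Fin p₂) (Fin p₁ ⊕ Fin p₂) ℝ :=
  Matrix.of fun a b => (fderiv ℝ (gradient f) θ (EuclideanSpace.single b 1)) a

/-- The outer product `∇f(θ) ∇f(θ)ᵀ`. -/
def gradOuter (f : Param p₁ p₂ → ℝ) (θ : Param p₁ p₂) :
    Matrix (Fin p₁ ⊕ Fin p₂) (Fin p₁ ⊕ Fin p₂) ℝ :=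
  Matrix.of fun a b => gradient f θ a * gradient f θ b

/-! ### Population quantities of one block with distribution `F` -/

/-- The population objective `E_F M(X; θ)`. -/
def popRisk (F : Measure (Obs d)) (M : Obs d → Param p₁ p₂ → ℝ) (θ : Param p₁ p₂) : ℝ :=
  ∫ x, M x θ ∂F

/-- `Ψ_θ^θ(θ) = E_F ∇²M(X; θ)`, entry by entry. -/
def popHess (F : Measure (Obs d)) (M : Obs d → Param p₁ p₂ → ℝ) (θ : Param p₁ p₂) :
    Matrix (Fin p₁ ⊕ Fin p₂) (Fin p₁ ⊕ Fin p₂) ℝ :=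
  Matrix.of fun a b => ∫ x, hess (M x) θ a b ∂F

/-- The partial Hessian `J_{φ|λ} = Ψ_φ^φ - Ψ_φ^λ (Ψ_λ^λ)⁻¹ Ψ_λ^φ`. -/
def partialHess (F : Measure (Obs d)) (M : Obs d → Param p₁ p₂ → ℝ) (θ : Param p₁ p₂) :
    Matrix (Fin p₁) (Fin p₁) ℝ :=
  (popHess F M θ).toBlocks₁₁ -
    (popHess F M θ).toBlocks₁₂ * ((popHess F M θ).toBlocks₂₂)⁻¹ * (popHess F M θ).toBlocks₂₁

/-- The adjusted score `S_φ(x; θ) = ψ_φ(x; θ) - Ψ_φ^λ (Ψ_λ^λ)⁻¹ ψ_λ(x; θ)`. -/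
def adjScore (F : Measure (Obs d)) (M : Obs d → Param p₁ p₂ → ℝ) (θ : Param p₁ p₂)
    (x : Obs d) : Fin p₁ → ℝ :=
  (fun a => gradient (M x) θ (Sum.inl a)) -
    ((popHess F M θ).toBlocks₁₂ * ((popHess F M θ).toBlocks₂₂)⁻¹).mulVec
      (fun b => gradient (M x) θ (Sum.inr b))

/-- The covariance matrix `Var_F S_φ(X; θ)`. -/
def scoreVar (F : Measure (Obs d)) (M : Obs d → Param p₁ p₂ → ℝ) (θ : Param p₁ p₂) :
    Matrix (Fin p₁) (Fin p₁) ℝ :=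
  Matrix.of fun a b => covariance (fun x => adjScore F M θ x a) (fun x => adjScore F M θ x b) F

/-- `∑_k γ_k J_k⁻¹ Σ_k J_k⁻¹`. -/
def covSaC (F : Fin K → Measure (Obs d)) (M : Obs d → Param p₁ p₂ → ℝ)
    (θs : Fin K → Param p₁ p₂) (γ : Fin K → ℝ) : Matrix (Fin p₁) (Fin p₁) ℝ :=
  ∑ k, γ k • ((partialHess (F k) M (θs k))⁻¹ * scoreVar (F k) M (θs k) *
    (partialHess (F k) M (θs k))⁻¹)

/-- `(∑_k γ_k J_k)⁻¹ (∑_k γ_k Σ_k) (∑_k γ_k J_k)⁻¹`. -/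
def covFull (F : Fin K → Measure (Obs d)) (M : Obs d → Param p₁ p₂ → ℝ)
    (θs : Fin K → Param p₁ p₂) (γ : Fin K → ℝ) : Matrix (Fin p₁) (Fin p₁) ℝ :=
  (∑ k, γ k • partialHess (F k) M (θs k))⁻¹ * (∑ k, γ k • scoreVar (F k) M (θs k)) *
    (∑ k, γ k • partialHess (F k) M (θs k))⁻¹

/-! ### Assumptions -/

/-- Sample sizes `n m k` of the blocks along a sequence of experiments `m = 0, 1, …`: the total
sample size `N` tends to infinity and `n_k / N → γ_k > 0`. -/
structure SampleSizes (n : ℕ → Fin K → ℕ) (γ : Fin K → ℝ) : Prop where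
  total_tendsto : Tendsto (fun m => ∑ k, n m k) atTop atTop
  ratio_tendsto : ∀ k, Tendsto (fun m => (n m k : ℝ) / ((∑ j, n m j : ℕ) : ℝ)) atTop (𝓝 (γ k))
  limit_pos : ∀ k, 0 < γ k

/-- `θ_k*` is the unique minimizer of `θ ↦ E M(X_{k,1}; θ)` (which is well defined) on `Θ_k`. -/
structure Identifiability (M : Obs d → Param p₁ p₂ → ℝ) (F : Fin K → Measure (Obs d))
    (Θ : Fin K → Set (Param p₁ p₂)) (θs : Fin K → Param p₁ p₂) : Prop where
  integrable : ∀ k, ∀ θ ∈ Θ k, Integrable (fun x => M x θ) (F k)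
  unique_min : ∀ k, ∀ θ ∈ Θ k, θ ≠ θs k → popRisk (F k) M (θs k) < popRisk (F k) M θ

/-- `Θ_k` is compact and convex with `θ_k*` in its interior. -/
structure Compactness (Θ : Fin K → Set (Param p₁ p₂)) (θs : Fin K → Param p₁ p₂) : Prop where
  compact : ∀ k, IsCompact (Θ k)
  convex : ∀ k, Convex ℝ (Θ k)
  interior : ∀ k, θs k ∈ interior (Θ k)

/-- The population objectives are twice differentiable at `θ_k*`, with `∇²M_k(θ_k*) ⪰ ρ₋ I`. -/
def LocalStrongConvexity (M : Obs d → Param p₁ p₂ → ℝ) (F : Fin K → Measure (Obs d))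
    (θs : Fin K → Param p₁ p₂) : Prop :=
  ∃ ρ : ℝ, 0 < ρ ∧ ∀ k, TwiceDifferentiableAt (popRisk (F k) M) (θs k) ∧
    (hess (popRisk (F k) M) (θs k) - ρ • (1 : Matrix _ _ ℝ)).PosSemidef

/-- Moment and Lipschitz conditions on the first two derivatives of `M`, with exponents `v, v₁`.
Norms of matrices are spectral norms. -/
def Smoothness (M : Obs d → Param p₁ p₂ → ℝ) (F : Fin K → Measure (Obs d))
    (θs : Fin K → Param p₁ p₂) (v v₁ : ℝ) : Prop :=
  ∃ (R L G₀ B₀ ρ : ℝ) (G B : Obs d → ℝ),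
    0 < R ∧ 0 < L ∧ 0 < G₀ ∧ 0 < B₀ ∧ 0 < ρ ∧ Measurable G ∧ Measurable B ∧
    ∀ k,
      (∀ x, ∀ θ ∈ Metric.closedBall (θs k) ρ, TwiceDifferentiableAt (M x) θ) ∧
      ∫⁻ x, ‖gradient (M x) (θs k)‖ₑ ^ (2 * v₁) ∂(F k) ≤ ENNReal.ofReal (R ^ (2 * v₁)) ∧
      ∫⁻ x, ‖hess (M x) (θs k) - hess (popRisk (F k) M) (θs k)‖ₑ ^ (2 * v) ∂(F k)
        ≤ ENNReal.ofReal (L ^ (2 * v)) ∧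
      (∀ x, ∀ θ ∈ Metric.closedBall (θs k) ρ, ∀ θ' ∈ Metric.closedBall (θs k) ρ,
        ‖hess (M x) θ - hess (M x) θ'‖ ≤ G x * ‖θ - θ'‖ ∧
        ‖gradOuter (M x) θ - gradOuter (M x) θ'‖ ≤ B x * ‖θ - θ'‖) ∧
      ∫⁻ x, ‖G x‖ₑ ^ (2 * v) ∂(F k) ≤ ENNReal.ofReal (G₀ ^ (2 * v)) ∧
      ∫⁻ x, ‖B x‖ₑ ^ (2 * v) ∂(F k) ≤ ENNReal.ofReal (B₀ ^ (2 * v))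

/-- The heterogeneous M-estimation model: block distributions `F_k`, a common objective `M` which
is convex in the parameter, parameter sets `Θ_k`, and true parameters `θ_k* = (φ*, λ_k*)`. -/
structure Model (M : Obs d → Param p₁ p₂ → ℝ) (F : Fin K → Measure (Obs d))
    (Θ : Fin K → Set (Param p₁ p₂)) (φs : EuclideanSpace ℝ (Fin p₁))
    (ls : Fin K → EuclideanSpace ℝ (Fin p₂)) (v v₁ : ℝ) : Prop where
  prob : ∀ k, IsProbabilityMeasure (F k)
  convex_obj : ∀ k x, ConvexOn ℝ (Θ k) (M x)
  identifiability : Identifiability M F Θ (fun k => join φs (ls k))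
  compactness : Compactness Θ (fun k => join φs (ls k))
  strong_convexity : LocalStrongConvexity M F (fun k => join φs (ls k))
  smoothness : Smoothness M F (fun k => join φs (ls k)) v v₁

/-! ### Data and estimators -/

/-- All observations `X_{k,i}` are independent, and `X_{k,i}` has distribution `F_k`. -/
structure IsSample {Ω : Type*} [MeasurableSpace Ω] (P : Measure Ω)
    (X : Fin K → ℕ → Ω → Obs d) (F : Fin K → Measure (Obs d)) : Prop where
  law : ∀ k i, HasLaw (X k i) (F k) P
  indep : iIndepFun (fun q : Fin K × ℕ => X q.1 q.2) P

/-- `∑_{i=1}^{n} M(x_i; θ)`. -/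
def empObj (M : Obs d → Param p₁ p₂ → ℝ) (x : ℕ → Obs d) (n : ℕ) (θ : Param p₁ p₂) : ℝ :=
  ∑ i ∈ Finset.range n, M (x i) θ

/-- `T m k` is the local M-estimator `(φ̂_k, λ̂_k)`: a random vector which almost surely minimizes
the objective of the `k`-th block over `Θ_k`. -/
structure IsLocalEstimator {Ω : Type*} [MeasurableSpace Ω] (P : Measure Ω)
    (M : Obs d → Param p₁ p₂ → ℝ) (Θ : Fin K → Set (Param p₁ p₂))
    (X : Fin K → ℕ → Ω → Obs d) (n : ℕ → Fin K → ℕ)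
    (T : ℕ → Fin K → Ω → Param p₁ p₂) : Prop where
  aemeasurable : ∀ m k, AEMeasurable (T m k) P
  argmin : ∀ m k, ∀ᵐ ω ∂P, T m k ω ∈ Θ k ∧
    IsMinOn (empObj M (fun i => X k i ω) (n m k)) (Θ k) (T m k ω)

/-- The full parameter space: all `(φ, λ_1, …, λ_K)` with `(φ, λ_k) ∈ Θ_k` for every `k`. -/
def fullSpace (Θ : Fin K → Set (Param p₁ p₂)) :
    Set (EuclideanSpace ℝ (Fin p₁) × (Fin K → EuclideanSpace ℝ (Fin p₂))) :=
  {t | ∀ k, join t.1 (t.2 k) ∈ Θ k}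

/-- `T m` is the full-sample M-estimator `(φ̂, λ̂_1, …, λ̂_K)`: a random vector which almost surely
minimizes `∑_k ∑_i M(X_{k,i}; φ, λ_k)` over the full parameter space. -/
structure IsFullEstimator {Ω : Type*} [MeasurableSpace Ω] (P : Measure Ω)
    (M : Obs d → Param p₁ p₂ → ℝ) (Θ : Fin K → Set (Param p₁ p₂))
    (X : Fin K → ℕ → Ω → Obs d) (n : ℕ → Fin K → ℕ)
    (T : ℕ → Ω → EuclideanSpace ℝ (Fin p₁) × (Fin K → EuclideanSpace ℝ (Fin p₂))) : Prop where
  aemeasurable : ∀ m, AEMeasurable (T m) P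
  argmin : ∀ m, ∀ᵐ ω ∂P, T m ω ∈ fullSpace Θ ∧
    IsMinOn (fun t => ∑ k, empObj M (fun i => X k i ω) (n m k) (join t.1 (t.2 k)))
      (fullSpace Θ) (T m ω)

/-- The split-and-conquer estimator `N⁻¹ ∑_k n_k φ̂_k`. -/
def sacEstimator {Ω : Type*} (n : ℕ → Fin K → ℕ) (T : ℕ → Fin K → Ω → Param p₁ p₂)
    (m : ℕ) (ω : Ω) : EuclideanSpace ℝ (Fin p₁) :=
  ((∑ k, n m k : ℕ) : ℝ)⁻¹ • ∑ k, (n m k : ℝ) • common (T m k ω)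

end

end SaC

/-
Each empirical objective is convex with a quadratic expansion at the true parameter. Convexity makes
this local expansion control the minimizer globally, so without a separate consistency argument the
minimizer over `Θ_k` (or over the full parameter space, seen as the linear constraint that all
blocks share the `φ` component) satisfies the linearized stationarity equation up to an error that
is small compared with the score. Testing this equation against the least favourable direction
`(u, -(Ψ_λ^λ)⁻¹ Ψ_λ^φ u)` eliminates the nuisance component of the displacement: the Hessian becomes
`J_k` and the score becomes the adjusted score. Both limits then follow from the central limit
theorem and the Cramér–Wold device, with `u = J_k⁻¹ v` for the split-and-conquer estimator and
`u = (∑ γ_k J_k)⁻¹ v` for the full one.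

For least squares with slope and intercept, two equally large blocks in which regressor and response
are independent signs scaled by `1` and by `2` have limiting variances `1` (split-and-conquer) and
`34 / 25` (full sample): the two local slope estimators are equally precise, so equal weights are
best, whereas pooling weights them by `J_k`, in the ratio `1 : 4`.
-/

namespace SaC

open scoped InnerProductSpace

/-! ### Minimizers of sums of convex functions -/

section Argmin

variable {E : Type*} [NormedAddCommGroup E] [InnerProductSpace ℝ E]

theorem eventually_half_mul_sq_le_inner {ι : Type*} {l : Filter ι} {A : ι → E →L[ℝ] E}
    {H : E →L[ℝ] E} {c : ℝ} (hc : 0 < c) (hH : ∀ h, c * ‖h‖ ^ 2 ≤ ⟪H h, h⟫_ℝ)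
    (hA : Tendsto A l (𝓝 H)) : ∀ᶠ i in l, ∀ h, c / 2 * ‖h‖ ^ 2 ≤ ⟪A i h, h⟫_ℝ := by
  have hdiff : Tendsto (fun i => ‖A i - H‖) l (𝓝 0) := tendsto_iff_norm_sub_tendsto_zero.1 hA
  filter_upwards [hdiff.eventually_le_const (half_pos hc)] with i hi h
  have hsplit : ⟪A i h, h⟫_ℝ = ⟪H h, h⟫_ℝ + ⟪(A i - H) h, h⟫_ℝ := by
    rw [← inner_add_left, sub_apply, add_sub_cancel]
  have hremainder : -(c / 2 * ‖h‖ ^ 2) ≤ ⟪(A i - H) h, h⟫_ℝ := by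
    refine neg_le_of_abs_le ((abs_real_inner_le_norm _ h).trans ?_)
    calc ‖(A i - H) h‖ * ‖h‖ ≤ c / 2 * ‖h‖ * ‖h‖ := by
          gcongr; exact (A i - H).le_of_opNorm_le hi h
      _ = c / 2 * ‖h‖ ^ 2 := by ring
  linarith [hH h]

theorem mul_mul_norm_sq_le_inner_smul {a b c : ℝ} (hb : 0 ≤ b) (hab : a ≤ b) (hc : 0 ≤ c)
    {A : E →L[ℝ] E} {u : E} (hA : c * ‖u‖ ^ 2 ≤ ⟪A u, u⟫_ℝ) :
    a * c * ‖u‖ ^ 2 ≤ ⟪(b • A) u, u⟫_ℝ := by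
  rw [smul_apply, real_inner_smul_left, mul_assoc]
  exact mul_le_mul hab hA (by positivity) hb

variable {κ : Type*} [Fintype κ]

/-- Among the displacements in `V` for which every `θ j + δ j` lies in `Θ j`, the displacement `δ`
minimizes `∑ j, f j (θ j + δ j)`. The subspace `V` encodes which coordinates the blocks share. -/
structure IsArgminDisplacement (V : Submodule ℝ (κ → E)) (Θ : κ → Set E) (θ : κ → E)
    (f : κ → E → ℝ) (δ : κ → E) : Prop where
  mem : δ ∈ V
  feasible : ∀ j, θ j + δ j ∈ Θ j
  sum_le_sum : ∀ δ' ∈ V, (∀ j, θ j + δ' j ∈ Θ j) →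
    ∑ j, f j (θ j + δ j) ≤ ∑ j, f j (θ j + δ' j)

theorem IsArgminDisplacement.const_smul {V : Submodule ℝ (κ → E)} {Θ : κ → Set E} {θ : κ → E}
    {f : κ → E → ℝ} {δ : κ → E} (hδ : IsArgminDisplacement V Θ θ f δ) {a : ℝ} (ha : 0 ≤ a) :
    IsArgminDisplacement V Θ θ (fun j => a • f j) δ where
  mem := hδ.mem
  feasible := hδ.feasible
  sum_le_sum δ' hδ' hmem := by
    simpa only [Pi.smul_apply, smul_eq_mul, ← Finset.mul_sum] using
      mul_le_mul_of_nonneg_left (hδ.sum_le_sum δ' hδ' hmem) ha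

variable [CompleteSpace E]

theorem hasLineDerivAt_of_hasGradientAt {f : E → ℝ} {x g : E} (hg : HasGradientAt f g x) (v : E) :
    HasLineDerivAt ℝ f ⟪g, v⟫_ℝ x v := by
  simpa using hg.hasFDerivAt.hasLineDerivAt v

theorem inner_gradient_le_of_convexOn {f : E → ℝ} {S : Set E} (hf : ConvexOn ℝ S f) {x y g : E}
    (hx : x ∈ S) (hy : y ∈ S) (hg : HasGradientAt f g x) : ⟪g, y - x⟫_ℝ ≤ f y - f x := by
  have hline : ConvexOn ℝ (AffineMap.lineMap x y ⁻¹' S) (f ∘ AffineMap.lineMap (k := ℝ) x y) :=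
    hf.comp_affineMap _
  have hderiv : HasDerivAt (f ∘ AffineMap.lineMap (k := ℝ) x y) ⟪g, y - x⟫_ℝ 0 := by
    refine HasDerivAt.congr_of_eventuallyEq (hasLineDerivAt_of_hasGradientAt hg (y - x))
      (.of_forall fun t => ?_)
    simp [AffineMap.lineMap_apply, add_comm]
  simpa [slope] using
    hline.le_slope_of_hasDerivAt (y := 1) (by simpa using hx) (by simpa using hy) one_pos hderiv

/-- The local regularity of a convex objective `f` on `Θ` which makes its minimizer computable to
first order: on the closed ball of radius `r` around `θ`, contained in `Θ`, the function has
gradient `g`, and `g` differs from its linearization at `θ` with slope `A` by at most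
`C ‖h‖ ^ 2`. -/
structure ConvexExpansion (Θ : Set E) (θ : E) (r : ℝ) (f : E → ℝ) (g : E → E) (A : E →L[ℝ] E)
    (C : ℝ) : Prop where
  closedBall_subset : Metric.closedBall θ r ⊆ Θ
  convexOn : ConvexOn ℝ Θ f
  hasGradientAt : ∀ η ∈ Metric.closedBall θ r, HasGradientAt f (g η) η
  norm_sub_sub_le : ∀ h, ‖h‖ ≤ r → ‖g (θ + h) - g θ - A h‖ ≤ C * ‖h‖ ^ 2

namespace ConvexExpansion

variable {Θ : Set E} {θ : E} {r C : ℝ} {f : E → ℝ} {g : E → E} {A : E →L[ℝ] E}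

theorem mono (hf : ConvexExpansion Θ θ r f g A C) {r' C' : ℝ} (hr : r' ≤ r) (hC : C ≤ C') :
    ConvexExpansion Θ θ r' f g A C' where
  closedBall_subset := (Metric.closedBall_subset_closedBall hr).trans hf.closedBall_subset
  convexOn := hf.convexOn
  hasGradientAt η hη := hf.hasGradientAt η (Metric.closedBall_subset_closedBall hr hη)
  norm_sub_sub_le h hh := (hf.norm_sub_sub_le h (hh.trans hr)).trans (by gcongr)

theorem const_smul (hf : ConvexExpansion Θ θ r f g A C) {a : ℝ} (ha : 0 ≤ a) :
    ConvexExpansion Θ θ r (a • f) (a • g) (a • A) (a * C) where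
  closedBall_subset := hf.closedBall_subset
  convexOn := hf.convexOn.smul ha
  hasGradientAt η hη := by
    have hfd := (hf.hasGradientAt η hη).hasFDerivAt.const_smul a
    rw [hasGradientAt_iff_hasFDerivAt]
    simpa using hfd
  norm_sub_sub_le h hh := by
    simp only [Pi.smul_apply, smul_apply, ← smul_sub, norm_smul, Real.norm_of_nonneg ha]
    rw [mul_assoc]
    exact mul_le_mul_of_nonneg_left (hf.norm_sub_sub_le h hh) ha

theorem sum {ι : Type*} {s : Finset ι} {f : ι → E → ℝ} {g : ι → E → E} {A : ι → E →L[ℝ] E}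
    {C : ι → ℝ} (hball : Metric.closedBall θ r ⊆ Θ) (hΘ : Convex ℝ Θ)
    (hf : ∀ i ∈ s, ConvexExpansion Θ θ r (f i) (g i) (A i) (C i)) :
    ConvexExpansion Θ θ r (∑ i ∈ s, f i) (∑ i ∈ s, g i) (∑ i ∈ s, A i) (∑ i ∈ s, C i) where
  closedBall_subset := hball
  convexOn := Finset.sum_induction f (ConvexOn ℝ Θ) (fun _ _ => ConvexOn.add)
    (convexOn_const 0 hΘ) fun i hi => (hf i hi).convexOn
  hasGradientAt η hη := by
    have hfd := HasFDerivAt.sum fun i hi => ((hf i hi).hasGradientAt η hη).hasFDerivAt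
    rw [hasGradientAt_iff_hasFDerivAt]
    simpa using hfd
  norm_sub_sub_le h hh := by
    simp only [Finset.sum_apply, _root_.sum_apply, ← Finset.sum_sub_distrib,
      Finset.sum_mul]
    exact norm_sum_le_of_le s fun i hi => (hf i hi).norm_sub_sub_le h hh

theorem neg_norm_mul_add_le_inner (hf : ConvexExpansion Θ θ r f g A C) {c : ℝ} {h : E}
    (hA : c * ‖h‖ ^ 2 ≤ ⟪A h, h⟫_ℝ) (hh : ‖h‖ ≤ r) (hC : C * ‖h‖ ≤ c / 2) :
    -(‖g θ‖ * ‖h‖) + c / 2 * ‖h‖ ^ 2 ≤ ⟪g (θ + h), h⟫_ℝ := by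
  have hsplit : ⟪g (θ + h), h⟫_ℝ =
      ⟪g θ, h⟫_ℝ + ⟪A h, h⟫_ℝ + ⟪g (θ + h) - g θ - A h, h⟫_ℝ := by
    rw [← inner_add_left, ← inner_add_left]
    congr 1
    abel
  have hscore := neg_le_of_abs_le (abs_real_inner_le_norm (g θ) h)
  have hremainder : -(c / 2 * ‖h‖ ^ 2) ≤ ⟪g (θ + h) - g θ - A h, h⟫_ℝ := by
    refine neg_le_of_abs_le ((abs_real_inner_le_norm _ h).trans ?_)
    calc ‖g (θ + h) - g θ - A h‖ * ‖h‖ ≤ C * ‖h‖ ^ 2 * ‖h‖ := by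
          gcongr; exact hf.norm_sub_sub_le h hh
      _ = C * ‖h‖ * ‖h‖ ^ 2 := by ring
      _ ≤ c / 2 * ‖h‖ ^ 2 := by gcongr
  linarith

end ConvexExpansion

theorem sum_inner_add_ge {Θ : κ → Set E} {θ : κ → E} {f : κ → E → ℝ} {g : κ → E → E}
    {A : κ → E →L[ℝ] E} {r c C : ℝ}
    (hf : ∀ j, ConvexExpansion (Θ j) (θ j) r (f j) (g j) (A j) C)
    (hA : ∀ j h, c * ‖h‖ ^ 2 ≤ ⟪A j h, h⟫_ℝ) (hC : 0 ≤ C) (hCr : C * r ≤ c / 2)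
    {h : κ → E} (hh : ‖WithLp.toLp 2 h‖ ≤ r) :
    -((∑ j, ‖g j (θ j)‖) * ‖WithLp.toLp 2 h‖) + c / 2 * ‖WithLp.toLp 2 h‖ ^ 2
      ≤ ∑ j, ⟪g j (θ j + h j), h j⟫_ℝ := by
  have hle : ∀ j, ‖h j‖ ≤ ‖WithLp.toLp 2 h‖ := PiLp.norm_apply_le (WithLp.toLp 2 h)
  calc _ = ∑ j, (-(‖g j (θ j)‖ * ‖WithLp.toLp 2 h‖) + c / 2 * ‖h j‖ ^ 2) := by
        rw [Finset.sum_add_distrib, Finset.sum_neg_distrib, ← Finset.sum_mul, ← Finset.mul_sum,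
          PiLp.norm_sq_eq_of_L2]
    _ ≤ _ := Finset.sum_le_sum fun j _ => by
        refine le_trans ?_ ((hf j).neg_norm_mul_add_le_inner (hA j (h j)) ((hle j).trans hh)
          ((mul_le_mul_of_nonneg_left ((hle j).trans hh) hC).trans hCr))
        gcongr
        exact hle j

namespace IsArgminDisplacement

variable {V : Submodule ℝ (κ → E)} {Θ : κ → Set E} {θ : κ → E} {f : κ → E → ℝ} {g : κ → E → E}
  {A : κ → E →L[ℝ] E} {r c C : ℝ} {δ : κ → E}

theorem sum_inner_gradient_smul_nonpos (hδ : IsArgminDisplacement V Θ θ f δ)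
    (hconv : ∀ j, ConvexOn ℝ (Θ j) (f j)) {τ : ℝ} (hτ : τ < 1)
    (hmem : ∀ j, θ j + τ • δ j ∈ Θ j) {u : κ → E}
    (hu : ∀ j, HasGradientAt (f j) (u j) (θ j + τ • δ j)) : ∑ j, ⟪u j, δ j⟫_ℝ ≤ 0 := by
  have htangent : ∀ j,
      (1 - τ) * ⟪u j, δ j⟫_ℝ ≤ f j (θ j + δ j) - f j (θ j + τ • δ j) := fun j => by
    have hle := inner_gradient_le_of_convexOn (hconv j) (hmem j) (hδ.feasible j) (hu j)
    have hdiff : θ j + δ j - (θ j + τ • δ j) = (1 - τ) • δ j := by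
      rw [sub_smul, one_smul]; abel
    rwa [hdiff, inner_smul_right] at hle
  have hsum : (1 - τ) * ∑ j, ⟪u j, δ j⟫_ℝ ≤ 0 := by
    have hmin := hδ.sum_le_sum (τ • δ) (V.smul_mem _ hδ.mem) hmem
    have hle := Finset.sum_le_sum fun j (_ : j ∈ Finset.univ) => htangent j
    rw [← Finset.mul_sum, Finset.sum_sub_distrib] at hle
    exact hle.trans (sub_nonpos.2 hmin)
  exact nonpos_of_mul_nonpos_right hsum (by linarith)

theorem norm_toLp_le (hδ : IsArgminDisplacement V Θ θ f δ) (hc : 0 < c) (hC : 0 ≤ C)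
    (hCr : C * r ≤ c / 2) (hf : ∀ j, ConvexExpansion (Θ j) (θ j) r (f j) (g j) (A j) C)
    (hA : ∀ j h, c * ‖h‖ ^ 2 ≤ ⟪A j h, h⟫_ℝ) (hsmall : 2 / c * ∑ j, ‖g j (θ j)‖ < r) :
    ‖WithLp.toLp 2 δ‖ ≤ 2 / c * ∑ j, ‖g j (θ j)‖ := by
  set b := ∑ j, ‖g j (θ j)‖
  by_contra! hlt
  obtain ⟨u, hu, hu'⟩ := exists_between (lt_min hlt hsmall)
  obtain ⟨hus, hur⟩ := lt_min_iff.1 hu'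
  have hb : 0 ≤ b := Finset.sum_nonneg fun j _ => norm_nonneg _
  have hu0 : 0 < u := lt_of_le_of_lt (by positivity) hu
  have hs0 := hu0.trans hus
  set τ := u / ‖WithLp.toLp 2 δ‖
  have hτ0 : 0 < τ := by positivity
  have hnorm : ‖WithLp.toLp 2 (τ • δ)‖ = u := by
    rw [WithLp.toLp_smul, norm_smul, Real.norm_of_nonneg hτ0.le, div_mul_cancel₀ _ hs0.ne']
  have hmem : ∀ j, θ j + τ • δ j ∈ Metric.closedBall (θ j) r := fun j => by
    simpa [mem_closedBall_iff_norm] using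
      (PiLp.norm_apply_le (WithLp.toLp 2 (τ • δ)) j).trans (hnorm.trans_le hur.le)
  have hdescent := hδ.sum_inner_gradient_smul_nonpos (fun j => (hf j).convexOn)
    ((div_lt_one hs0).2 hus) (fun j => (hf j).closedBall_subset (hmem j))
    fun j => (hf j).hasGradientAt _ (hmem j)
  have hgrowth := sum_inner_add_ge hf hA hC hCr (h := τ • δ) (hnorm.trans_le hur.le)
  simp only [Pi.smul_apply, inner_smul_right, ← Finset.mul_sum, hnorm] at hgrowth
  have hle := hgrowth.trans (mul_nonpos_of_nonneg_of_nonpos hτ0.le hdescent)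
  rw [div_mul_eq_mul_div, div_lt_iff₀ hc] at hu
  nlinarith

theorem sum_inner_gradient_eq_zero (hδ : IsArgminDisplacement V Θ θ f δ)
    (hnhds : ∀ j, Θ j ∈ 𝓝 (θ j + δ j)) {u : κ → E}
    (hu : ∀ j, HasGradientAt (f j) (u j) (θ j + δ j)) {h : κ → E} (hh : h ∈ V) :
    ∑ j, ⟪u j, h j⟫_ℝ = 0 := by
  have hderiv : HasDerivAt (fun t : ℝ => ∑ j, f j (θ j + δ j + t • h j)) (∑ j, ⟪u j, h j⟫_ℝ) 0 :=
    HasDerivAt.fun_sum fun j _ => hasLineDerivAt_of_hasGradientAt (hu j) (h j)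
  refine IsLocalMin.hasDerivAt_eq_zero ?_ hderiv
  have hfeas : ∀ᶠ t : ℝ in 𝓝 0, ∀ j, θ j + δ j + t • h j ∈ Θ j := by
    refine eventually_all.2 fun j => ?_
    have hcont : Continuous fun t : ℝ => θ j + δ j + t • h j := by fun_prop
    exact hcont.tendsto' 0 (θ j + δ j) (by simp) (hnhds j)
  filter_upwards [hfeas] with t ht
  simpa [add_assoc] using hδ.sum_le_sum (δ + t • h) (V.add_mem hδ.mem (V.smul_mem t hh))
    fun j => by simpa [add_assoc] using ht j

theorem abs_sum_inner_linearization_le (hδ : IsArgminDisplacement V Θ θ f δ) (hc : 0 < c)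
    (hC : 0 ≤ C) (hCr : C * r ≤ c / 2)
    (hf : ∀ j, ConvexExpansion (Θ j) (θ j) r (f j) (g j) (A j) C)
    (hA : ∀ j h, c * ‖h‖ ^ 2 ≤ ⟪A j h, h⟫_ℝ) (hsmall : 2 / c * ∑ j, ‖g j (θ j)‖ < r)
    (Q : κ → E →L[ℝ] E) {h : κ → E} (hh : h ∈ V) :
    |∑ j, ⟪Q j (δ j) + g j (θ j), h j⟫_ℝ| ≤
      (∑ j, (‖Q j - A j‖ + C * (2 / c * ∑ i, ‖g i (θ i)‖)) * ‖h j‖) *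
        (2 / c * ∑ j, ‖g j (θ j)‖) := by
  set β := 2 / c * ∑ j, ‖g j (θ j)‖
  have hnorm : ∀ j, ‖δ j‖ ≤ β := fun j =>
    (PiLp.norm_apply_le (WithLp.toLp 2 δ) j).trans (hδ.norm_toLp_le hc hC hCr hf hA hsmall)
  have hball : ∀ j, θ j + δ j ∈ Metric.ball (θ j) r := fun j => by
    simpa [mem_ball_iff_norm] using (hnorm j).trans_lt hsmall
  have hstationary := hδ.sum_inner_gradient_eq_zero
    (fun j => mem_of_superset (Metric.isOpen_ball.mem_nhds (hball j))
      (Metric.ball_subset_closedBall.trans (hf j).closedBall_subset))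
    (fun j => (hf j).hasGradientAt _ (Metric.ball_subset_closedBall (hball j))) hh
  have hsplit : ∑ j, ⟪Q j (δ j) + g j (θ j), h j⟫_ℝ =
      ∑ j, ⟪(Q j - A j) (δ j) - (g j (θ j + δ j) - g j (θ j) - A j (δ j)), h j⟫_ℝ := by
    rw [← sub_zero (∑ j, ⟪Q j (δ j) + g j (θ j), h j⟫_ℝ), ← hstationary,
      ← Finset.sum_sub_distrib]
    refine Finset.sum_congr rfl fun j _ => ?_
    rw [← inner_sub_left, sub_apply]
    congr 1
    abel
  rw [hsplit, Finset.sum_mul]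
  refine (Finset.abs_sum_le_sum_abs _ _).trans (Finset.sum_le_sum fun j _ => ?_)
  have hslope : ‖(Q j - A j) (δ j)‖ ≤ ‖Q j - A j‖ * β :=
    (Q j - A j).le_opNorm_of_le (hnorm j)
  have hremainder : ‖g j (θ j + δ j) - g j (θ j) - A j (δ j)‖ ≤ C * β ^ 2 :=
    ((hf j).norm_sub_sub_le _ ((hnorm j).trans hsmall.le)).trans (by gcongr; exact hnorm j)
  calc _ ≤ ‖(Q j - A j) (δ j) - (g j (θ j + δ j) - g j (θ j) - A j (δ j))‖ * ‖h j‖ :=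
        abs_real_inner_le_norm _ _
    _ ≤ (‖Q j - A j‖ * β + C * β ^ 2) * ‖h j‖ := by
        gcongr; exact (norm_sub_le _ _).trans (add_le_add hslope hremainder)
    _ = _ := by ring

end IsArgminDisplacement

theorem isLittleO_argmin_linearization {V : Submodule ℝ (κ → E)} {Θ : κ → Set E} {θ : κ → E}
    {f : ℕ → κ → E → ℝ} {g : ℕ → κ → E → E} {A Q : ℕ → κ → E →L[ℝ] E} {H : κ → E →L[ℝ] E}
    {C : ℕ → κ → ℝ} {C₀ : κ → ℝ} {δ : ℕ → κ → E} {r c : ℝ} (hr : 0 < r) (hc : 0 < c)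
    (hf : ∀ m j, ConvexExpansion (Θ j) (θ j) r (f m j) (g m j) (A m j) (C m j))
    (hH : ∀ j h, c * ‖h‖ ^ 2 ≤ ⟪H j h, h⟫_ℝ)
    (hA : ∀ j, Tendsto (fun m => A m j) atTop (𝓝 (H j)))
    (hQ : ∀ j, Tendsto (fun m => Q m j) atTop (𝓝 (H j)))
    (hC : ∀ j, Tendsto (fun m => C m j) atTop (𝓝 (C₀ j)))
    (hg : ∀ j, Tendsto (fun m => g m j (θ j)) atTop (𝓝 0))
    (hδ : ∀ m, IsArgminDisplacement V Θ θ (f m) (δ m)) {h : κ → E} (hh : h ∈ V) :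
    (fun m => ∑ j, ⟪Q m j (δ m j) + g m j (θ j), h j⟫_ℝ)
      =o[atTop] fun m => ∑ j, ‖g m j (θ j)‖ := by
  obtain ⟨D, hD, hCD⟩ : ∃ D, 0 < D ∧ ∀ᶠ m in atTop, ∀ j, C m j ≤ D := by
    obtain ⟨D, hD⟩ := (tendsto_pi_nhds.2 hC).norm.isBoundedUnder_le.eventually_le
    refine ⟨max D 1, by positivity, hD.mono fun m hm j => ?_⟩
    exact ((le_abs_self _).trans (norm_le_pi_norm (C m) j)).trans (hm.trans (le_max_left _ _))
  obtain ⟨r', hr', hr'r, hDr'⟩ : ∃ r', 0 < r' ∧ r' ≤ r ∧ D * r' ≤ c / 2 / 2 := by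
    refine ⟨min r (c / 2 / 2 / D), by positivity, min_le_left _ _, ?_⟩
    rw [← le_div_iff₀' hD]
    exact min_le_right _ _
  set β : ℕ → ℝ := fun m => 2 / (c / 2) * ∑ j, ‖g m j (θ j)‖
  have hβ : Tendsto β atTop (𝓝 0) := by
    simpa using (tendsto_finsetSum Finset.univ fun j _ => (hg j).norm).const_mul (2 / (c / 2))
  set ε : ℕ → ℝ := fun m => ∑ j, (‖Q m j - A m j‖ + D * β m) * ‖h j‖
  have hε : Tendsto ε atTop (𝓝 0) := by
    have hQA : ∀ j, Tendsto (fun m => ‖Q m j - A m j‖) atTop (𝓝 0) := fun j => by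
      simpa using ((hQ j).sub (hA j)).norm
    simpa using tendsto_finsetSum Finset.univ fun j _ =>
      ((hQA j).add (hβ.const_mul D)).mul_const ‖h j‖
  have hbound : ∀ᶠ m in atTop, |∑ j, ⟪Q m j (δ m j) + g m j (θ j), h j⟫_ℝ| ≤ ε m * β m := by
    have hcoercive : ∀ᶠ m in atTop, ∀ j h, c / 2 * ‖h‖ ^ 2 ≤ ⟪A m j h, h⟫_ℝ :=
      eventually_all.2 fun j => eventually_half_mul_sq_le_inner hc (hH j) (hA j)
    filter_upwards [hCD, hcoercive, hβ.eventually_lt_const hr'] with m hCm hAm hsmall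
    exact (hδ m).abs_sum_inner_linearization_le (half_pos hc) hD.le hDr'
      (fun j => (hf m j).mono hr'r (hCm j)) hAm hsmall (Q m) hh
  refine (Asymptotics.IsBigO.of_bound' (g := fun m => ε m * β m) ?_).trans_isLittleO ?_
  · exact hbound.mono fun m hm => hm.trans (le_abs_self _)
  · simpa using ((Asymptotics.isLittleO_one_iff ℝ).2 hε).mul_isBigO
      (Asymptotics.isBigO_const_mul_self (2 / (c / 2)) (fun m => ∑ j, ‖g m j (θ j)‖) atTop)

end Argmin

/-! ### Measurability and moments of derivatives -/

section Measurability

variable {α : Type*} [MeasurableSpace α] {μ : Measure α}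

theorem lintegral_rpow_lt_top_of_le [IsFiniteMeasure μ] {f : α → ENNReal} {p q : ℝ} (hp : 0 ≤ p)
    (hpq : p ≤ q) (hf : ∫⁻ x, f x ^ q ∂μ < ⊤) : ∫⁻ x, f x ^ p ∂μ < ⊤ := by
  have hle : ∀ x, f x ^ p ≤ 1 + f x ^ q := fun x => by
    rcases le_total (f x) 1 with h | h
    · exact (ENNReal.rpow_le_one h hp).trans le_self_add
    · exact (ENNReal.rpow_le_rpow_of_exponent_le h hpq).trans le_add_self
  refine (lintegral_mono hle).trans_lt ?_
  rw [lintegral_add_left measurable_const, lintegral_one]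
  exact ENNReal.add_lt_top.2 ⟨measure_lt_top μ _, hf⟩

theorem lintegral_enorm_lt_top_of_sub_const {H : Type*} [NormedAddCommGroup H]
    [IsFiniteMeasure μ] {f : α → H} (a : H)
    (hf : ∫⁻ x, ‖f x - a‖ₑ ∂μ < ⊤) : ∫⁻ x, ‖f x‖ₑ ∂μ < ⊤ := by
  have hle : ∀ x, ‖f x‖ₑ ≤ ‖f x - a‖ₑ + ‖a‖ₑ := fun x => by
    simpa using enorm_add_le (f x - a) a
  refine (lintegral_mono hle).trans_lt ?_
  rw [lintegral_add_right _ measurable_const, lintegral_const]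
  exact ENNReal.add_lt_top.2 ⟨hf, ENNReal.mul_lt_top enorm_lt_top (measure_lt_top _ _)⟩

variable {E H : Type*} [NormedAddCommGroup E] [NormedSpace ℝ E] [NormedAddCommGroup H]
  [NormedSpace ℝ H]

theorem aestronglyMeasurable_fderiv_apply {f : α → E → H} {θ : E}
    (hf : ∀ᶠ η in 𝓝 θ, AEStronglyMeasurable (fun x => f x η) μ)
    (hd : ∀ x, DifferentiableAt ℝ (f x) θ) (v : E) :
    AEStronglyMeasurable (fun x => fderiv ℝ (f x) θ v) μ := by
  have hcast : Tendsto (fun n : ℕ => (n : ℝ)) atTop atTop := tendsto_natCast_atTop_atTop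
  have hθ : Tendsto (fun n : ℕ => θ + (n : ℝ)⁻¹ • v) atTop (𝓝 θ) := by
    simpa using ((tendsto_inv_atTop_zero.comp hcast).smul_const v).const_add θ
  obtain ⟨n₀, hn₀⟩ := eventually_atTop.1 (hθ.eventually hf)
  have hshift : Tendsto (fun n : ℕ => n + n₀) atTop atTop := tendsto_add_atTop_nat n₀
  refine aestronglyMeasurable_of_tendsto_ae atTop
    (f := fun n x => ((n + n₀ : ℕ) : ℝ) • (f x (θ + ((n + n₀ : ℕ) : ℝ)⁻¹ • v) - f x θ))
    (fun n => ?_) (.of_forall fun x => ?_)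
  · exact ((hn₀ (n + n₀) (Nat.le_add_left _ _)).sub hf.self_of_nhds).const_smul _
  · exact (hd x).hasFDerivAt.lim v (tendsto_norm_atTop_atTop.comp (hcast.comp hshift))

theorem aestronglyMeasurable_of_forall_apply [FiniteDimensional ℝ E] {L : α → E →L[ℝ] H}
    (hL : ∀ v, AEStronglyMeasurable (fun x => L x v) μ) : AEStronglyMeasurable L μ := by
  let b := Module.finBasis ℝ E
  have hexpand : L = fun x => ∑ i, ContinuousLinearMap.smulRightL ℝ E H
      (b.coord i).toContinuousLinearMap (L x (b i)) := by
    ext x v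
    conv_lhs => rw [← b.sum_repr v, map_sum]
    simp [ContinuousLinearMap.smulRightL, sum_apply]
  rw [hexpand]
  exact Finset.aestronglyMeasurable_fun_sum _ fun i _ =>
    (ContinuousLinearMap.continuous _).comp_aestronglyMeasurable (hL (b i))

theorem aestronglyMeasurable_fderiv_param [FiniteDimensional ℝ E] {f : α → E → H} {θ : E}
    (hf : ∀ᶠ η in 𝓝 θ, AEStronglyMeasurable (fun x => f x η) μ)
    (hd : ∀ x, DifferentiableAt ℝ (f x) θ) :
    AEStronglyMeasurable (fun x => fderiv ℝ (f x) θ) μ :=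
  aestronglyMeasurable_of_forall_apply (aestronglyMeasurable_fderiv_apply hf hd)

end Measurability

section Matrix

theorem posDef_of_posSemidef_sub {ι : Type*} [DecidableEq ι] {A : Matrix ι ι ℝ} {c : ℝ} (hc : 0 < c)
    (hA : (A - c • (1 : Matrix ι ι ℝ)).PosSemidef) : A.PosDef := by
  simpa using Matrix.PosDef.posSemidef_add hA (Matrix.PosDef.one.smul hc)

variable {ι : Type*} [Fintype ι] [DecidableEq ι]

theorem inner_toEuclideanCLM (A : Matrix ι ι ℝ) (x y : EuclideanSpace ℝ ι) :
    ⟪Matrix.toEuclideanCLM (𝕜 := ℝ) A x, y⟫_ℝ = y ⬝ᵥ A.mulVec x := by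
  rw [EuclideanSpace.inner_eq_star_dotProduct, Matrix.ofLp_toEuclideanCLM, star_trivial]

theorem mul_norm_sq_le_inner_of_posSemidef_sub {A : Matrix ι ι ℝ} {c : ℝ}
    (hA : (A - c • (1 : Matrix ι ι ℝ)).PosSemidef) (h : EuclideanSpace ℝ ι) :
    c * ‖h‖ ^ 2 ≤ ⟪Matrix.toEuclideanCLM (𝕜 := ℝ) A h, h⟫_ℝ := by
  have hnonneg := hA.dotProduct_mulVec_nonneg h
  rw [star_trivial, ← inner_toEuclideanCLM, map_sub, map_smul, map_one, sub_apply, smul_apply,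
    one_apply_eq_self, inner_sub_left, real_inner_smul_left, real_inner_self_eq_norm_sq] at hnonneg
  linarith

end Matrix

variable {d p₁ p₂ K : ℕ}

section Hessian

variable {f : Param p₁ p₂ → ℝ} {θ : Param p₁ p₂}

theorem fderiv_gradient_eq_hess (f : Param p₁ p₂ → ℝ) (θ : Param p₁ p₂) :
    fderiv ℝ (gradient f) θ = Matrix.toEuclideanCLM (𝕜 := ℝ) (hess f θ) := by
  refine ContinuousLinearMap.coe_injective ((EuclideanSpace.basisFun _ ℝ).toBasis.ext fun b => ?_)
  ext a
  simp [hess, Matrix.ofLp_toEuclideanCLM]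

theorem norm_fderiv_gradient (f : Param p₁ p₂ → ℝ) (θ : Param p₁ p₂) :
    ‖fderiv ℝ (gradient f) θ‖ = ‖hess f θ‖ := by
  rw [fderiv_gradient_eq_hess, Matrix.l2_opNorm_toEuclideanCLM]

theorem norm_fderiv_gradient_sub (f : Param p₁ p₂ → ℝ) (η θ : Param p₁ p₂) :
    ‖fderiv ℝ (gradient f) η - fderiv ℝ (gradient f) θ‖ = ‖hess f η - hess f θ‖ := by
  rw [fderiv_gradient_eq_hess, fderiv_gradient_eq_hess, ← map_sub, Matrix.l2_opNorm_toEuclideanCLM]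

theorem norm_gradient_sub_sub_le {r G : ℝ}
    (hd : ∀ η ∈ Metric.closedBall θ r, TwiceDifferentiableAt f η)
    (hL : ∀ η ∈ Metric.closedBall θ r, ‖hess f η - hess f θ‖ ≤ G * ‖η - θ‖)
    {h : Param p₁ p₂} (hh : ‖h‖ ≤ r) :
    ‖gradient f (θ + h) - gradient f θ - fderiv ℝ (gradient f) θ h‖ ≤ |G| * ‖h‖ ^ 2 := by
  have hsub : Metric.closedBall θ ‖h‖ ⊆ Metric.closedBall θ r :=
    Metric.closedBall_subset_closedBall hh
  have hderiv : ∀ η ∈ Metric.closedBall θ ‖h‖,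
      ‖fderiv ℝ (gradient f) η - fderiv ℝ (gradient f) θ‖ ≤ |G| * ‖h‖ := fun η hη => by
    rw [norm_fderiv_gradient_sub]
    exact (hL η (hsub hη)).trans (mul_le_mul (le_abs_self G) (mem_closedBall_iff_norm.1 hη)
      (norm_nonneg _) (abs_nonneg _))
  have hmvt := (convex_closedBall θ ‖h‖).norm_image_sub_le_of_norm_fderiv_le' (x := θ)
    (y := θ + h) (fun η hη => (hd η (hsub hη)).2) hderiv (by simp) (by simp)
  rwa [add_sub_cancel_left, mul_assoc, ← sq] at hmvt

end Hessian

/-! ### Regularity of one block -/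

/-- The conditions on one block, with distribution `F`, objective `M` and parameter set `Θ`, under
which its M-estimator is asymptotically linear at `θ`: the objective is convex, the population risk
has a local minimum at `θ` with Hessian at least `c`, and on the closed ball of radius `r` around
`θ` the objective is twice differentiable, with Hessian Lipschitz at `θ` with integrable constant
`G x`. The moments are lower integrals because the measurability of the derivatives is not assumed
but follows from that of the objective. -/
structure RegularBlock (F : Measure (Obs d)) (M : Obs d → Param p₁ p₂ → ℝ)
    (Θ : Set (Param p₁ p₂)) (θ : Param p₁ p₂) (G : Obs d → ℝ) (c r : ℝ) : Prop where
  curvature_pos : 0 < c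
  radius_pos : 0 < r
  closedBall_subset : Metric.closedBall θ r ⊆ Θ
  convexOn : ∀ x, ConvexOn ℝ Θ (M x)
  integrable : ∀ η ∈ Metric.closedBall θ r, Integrable (fun x => M x η) F
  isLocalMin : IsLocalMin (popRisk F M) θ
  posSemidef : (hess (popRisk F M) θ - c • (1 : Matrix _ _ ℝ)).PosSemidef
  twiceDifferentiableAt : ∀ x, ∀ η ∈ Metric.closedBall θ r, TwiceDifferentiableAt (M x) η
  lintegral_score_lt_top : ∫⁻ x, ‖gradient (M x) θ‖ₑ ^ (2 : ℝ) ∂F < ⊤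
  lintegral_hess_lt_top : ∫⁻ x, ‖hess (M x) θ‖ₑ ∂F < ⊤
  norm_hess_sub_le : ∀ x, ∀ η ∈ Metric.closedBall θ r,
    ‖hess (M x) η - hess (M x) θ‖ ≤ G x * ‖η - θ‖
  integrable_lipschitz : Integrable G F

namespace RegularBlock

variable {F : Measure (Obs d)} {M : Obs d → Param p₁ p₂ → ℝ} {Θ : Set (Param p₁ p₂)}
  {θ : Param p₁ p₂} {G : Obs d → ℝ} {c r : ℝ}

theorem differentiableAt (hB : RegularBlock F M Θ θ G c r) (x : Obs d) {η : Param p₁ p₂}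
    (hη : η ∈ Metric.closedBall θ r) : DifferentiableAt ℝ (M x) η :=
  (hB.twiceDifferentiableAt x η hη).1.self_of_nhds

theorem convexExpansion (hB : RegularBlock F M Θ θ G c r) (x : Obs d) :
    ConvexExpansion Θ θ r (M x) (gradient (M x)) (fderiv ℝ (gradient (M x)) θ) |G x| where
  closedBall_subset := hB.closedBall_subset
  convexOn := hB.convexOn x
  hasGradientAt _ hη := (hB.differentiableAt x hη).hasGradientAt
  norm_sub_sub_le _ hh := norm_gradient_sub_sub_le (hB.twiceDifferentiableAt x)
    (hB.norm_hess_sub_le x) hh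

theorem norm_fderiv_gradient_le (hB : RegularBlock F M Θ θ G c r) (x : Obs d) {η : Param p₁ p₂}
    (hη : η ∈ Metric.closedBall θ r) :
    ‖fderiv ℝ (gradient (M x)) η‖ ≤ ‖fderiv ℝ (gradient (M x)) θ‖ + |G x| * r := by
  have hlip : ‖fderiv ℝ (gradient (M x)) η - fderiv ℝ (gradient (M x)) θ‖ ≤ |G x| * r := by
    rw [norm_fderiv_gradient_sub]
    exact (hB.norm_hess_sub_le x η hη).trans (mul_le_mul (le_abs_self _)
      (mem_closedBall_iff_norm.1 hη) (norm_nonneg _) (abs_nonneg _))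
  calc _ = ‖fderiv ℝ (gradient (M x)) θ
        + (fderiv ℝ (gradient (M x)) η - fderiv ℝ (gradient (M x)) θ)‖ := by
        rw [add_sub_cancel]
    _ ≤ _ := (norm_add_le _ _).trans (add_le_add_right hlip _)

theorem norm_gradient_le (hB : RegularBlock F M Θ θ G c r) (x : Obs d) {η : Param p₁ p₂}
    (hη : η ∈ Metric.closedBall θ r) :
    ‖gradient (M x) η‖ ≤
      ‖gradient (M x) θ‖ + (‖fderiv ℝ (gradient (M x)) θ‖ + |G x| * r) * r := by
  have hmvt := (convex_closedBall θ r).norm_image_sub_le_of_norm_fderiv_le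
    (fun ζ hζ => (hB.twiceDifferentiableAt x ζ hζ).2)
    (fun ζ hζ => hB.norm_fderiv_gradient_le x hζ)
    (Metric.mem_closedBall_self hB.radius_pos.le) hη
  have hr := hB.radius_pos
  have hdist : ‖η - θ‖ ≤ r := mem_closedBall_iff_norm.1 hη
  calc ‖gradient (M x) η‖ = ‖gradient (M x) θ + (gradient (M x) η - gradient (M x) θ)‖ := by
        rw [add_sub_cancel]
    _ ≤ _ := (norm_add_le _ _).trans (add_le_add_right (hmvt.trans (by gcongr)) _)

theorem eventually_aestronglyMeasurable (hB : RegularBlock F M Θ θ G c r) {η : Param p₁ p₂}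
    (hη : η ∈ Metric.ball θ r) : ∀ᶠ ζ in 𝓝 η, AEStronglyMeasurable (fun x => M x ζ) F := by
  filter_upwards [Metric.isOpen_ball.mem_nhds hη] with ζ hζ
  exact (hB.integrable ζ (Metric.ball_subset_closedBall hζ)).aestronglyMeasurable

theorem aestronglyMeasurable_fderiv (hB : RegularBlock F M Θ θ G c r) {η : Param p₁ p₂}
    (hη : η ∈ Metric.ball θ r) : AEStronglyMeasurable (fun x => fderiv ℝ (M x) η) F :=
  aestronglyMeasurable_fderiv_param (hB.eventually_aestronglyMeasurable hη)
    fun x => hB.differentiableAt x (Metric.ball_subset_closedBall hη)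

theorem aestronglyMeasurable_gradient (hB : RegularBlock F M Θ θ G c r) {η : Param p₁ p₂}
    (hη : η ∈ Metric.ball θ r) : AEStronglyMeasurable (fun x => gradient (M x) η) F :=
  (InnerProductSpace.toDual ℝ (Param p₁ p₂)).symm.continuous.comp_aestronglyMeasurable
    (hB.aestronglyMeasurable_fderiv hη)

theorem eventually_aestronglyMeasurable_gradient (hB : RegularBlock F M Θ θ G c r) :
    ∀ᶠ η in 𝓝 θ, AEStronglyMeasurable (fun x => gradient (M x) η) F := by
  filter_upwards [Metric.ball_mem_nhds θ hB.radius_pos] with η hη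
  exact hB.aestronglyMeasurable_gradient hη

theorem integrable_fderiv_gradient (hB : RegularBlock F M Θ θ G c r) :
    Integrable (fun x => fderiv ℝ (gradient (M x)) θ) F := by
  have hmeas : AEStronglyMeasurable (fun x => fderiv ℝ (gradient (M x)) θ) F :=
    aestronglyMeasurable_fderiv_param hB.eventually_aestronglyMeasurable_gradient fun x =>
      (hB.twiceDifferentiableAt x θ (Metric.mem_closedBall_self hB.radius_pos.le)).2
  refine ⟨hmeas, ?_⟩
  have hnorm : ∀ x, ‖fderiv ℝ (gradient (M x)) θ‖ₑ = ‖hess (M x) θ‖ₑ := fun x => by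
    rw [← enorm_norm, norm_fderiv_gradient, enorm_norm]
  simpa only [HasFiniteIntegral, hnorm] using hB.lintegral_hess_lt_top

theorem memLp_score (hB : RegularBlock F M Θ θ G c r) :
    MemLp (fun x => gradient (M x) θ) 2 F := by
  refine ⟨hB.aestronglyMeasurable_gradient (Metric.mem_ball_self hB.radius_pos), ?_⟩
  rw [eLpNorm_lt_top_iff_lintegral_rpow_enorm_lt_top two_ne_zero ENNReal.ofNat_ne_top]
  exact hB.lintegral_score_lt_top

variable [IsFiniteMeasure F]

theorem integrable_score (hB : RegularBlock F M Θ θ G c r) :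
    Integrable (fun x => gradient (M x) θ) F :=
  hB.memLp_score.integrable one_le_two

theorem integrable_gradientBound (hB : RegularBlock F M Θ θ G c r) : Integrable (fun x =>
    ‖gradient (M x) θ‖ + (‖fderiv ℝ (gradient (M x)) θ‖ + |G x| * r) * r) F :=
  hB.integrable_score.norm.add
    ((hB.integrable_fderiv_gradient.norm.add (hB.integrable_lipschitz.abs.mul_const r)).mul_const r)

theorem integrable_gradient (hB : RegularBlock F M Θ θ G c r) {η : Param p₁ p₂}
    (hη : η ∈ Metric.ball θ r) : Integrable (fun x => gradient (M x) η) F :=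
  hB.integrable_gradientBound.mono' (hB.aestronglyMeasurable_gradient hη)
    (.of_forall fun x => hB.norm_gradient_le x (Metric.ball_subset_closedBall hη))

theorem hasGradientAt_popRisk (hB : RegularBlock F M Θ θ G c r) {η : Param p₁ p₂}
    (hη : η ∈ Metric.ball θ r) :
    HasGradientAt (popRisk F M) (∫ x, gradient (M x) η ∂F) η := by
  have hnorm : ∀ x ζ, ζ ∈ Metric.ball θ r → ‖fderiv ℝ (M x) ζ‖ ≤
      ‖gradient (M x) θ‖ + (‖fderiv ℝ (gradient (M x)) θ‖ + |G x| * r) * r := fun x ζ hζ => by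
    rw [← toDual_gradient, LinearIsometryEquiv.norm_map]
    exact hB.norm_gradient_le x (Metric.ball_subset_closedBall hζ)
  have hderiv : HasFDerivAt (popRisk F M) (∫ x, fderiv ℝ (M x) η ∂F) η :=
    hasFDerivAt_integral_of_dominated_of_fderiv_le (F := fun ζ x => M x ζ)
      (F' := fun ζ x => fderiv ℝ (M x) ζ) (Metric.isOpen_ball.mem_nhds hη)
      (hB.eventually_aestronglyMeasurable hη)
      (hB.integrable η (Metric.ball_subset_closedBall hη)) (hB.aestronglyMeasurable_fderiv hη)
      (.of_forall fun x ζ hζ => hnorm x ζ hζ) hB.integrable_gradientBound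
      (.of_forall fun x ζ hζ =>
        (hB.differentiableAt x (Metric.ball_subset_closedBall hζ)).hasFDerivAt)
  have hint : Integrable (fun x => fderiv ℝ (M x) η) F :=
    hB.integrable_gradientBound.mono' (hB.aestronglyMeasurable_fderiv hη)
      (.of_forall fun x => hnorm x η hη)
  have hdual : InnerProductSpace.toDual ℝ (Param p₁ p₂) (∫ x, gradient (M x) η ∂F) =
      ∫ x, fderiv ℝ (M x) η ∂F := ContinuousLinearMap.ext fun w => by
    rw [InnerProductSpace.toDual_apply_apply, ContinuousLinearMap.integral_apply hint,
      real_inner_comm, ← integral_inner (hB.integrable_gradient hη)]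
    simp_rw [← inner_gradient_left, real_inner_comm]
  exact hasGradientAt_iff_hasFDerivAt.2 (hdual ▸ hderiv)

theorem integral_score (hB : RegularBlock F M Θ θ G c r) : ∫ x, gradient (M x) θ ∂F = 0 := by
  have hgrad := hB.hasGradientAt_popRisk (Metric.mem_ball_self hB.radius_pos)
  simpa using hB.isLocalMin.hasFDerivAt_eq_zero hgrad.hasFDerivAt

theorem fderiv_gradient_popRisk (hB : RegularBlock F M Θ θ G c r) :
    fderiv ℝ (gradient (popRisk F M)) θ = ∫ x, fderiv ℝ (gradient (M x)) θ ∂F := by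
  have hball := Metric.ball_mem_nhds θ hB.radius_pos
  have hderiv : HasFDerivAt (fun η => ∫ x, gradient (M x) η ∂F)
      (∫ x, fderiv ℝ (gradient (M x)) θ ∂F) θ :=
    hasFDerivAt_integral_of_dominated_of_fderiv_le (F := fun ζ x => gradient (M x) ζ)
      (F' := fun ζ x => fderiv ℝ (gradient (M x)) ζ) hball
      hB.eventually_aestronglyMeasurable_gradient hB.integrable_score
      hB.integrable_fderiv_gradient.aestronglyMeasurable
      (.of_forall fun x η hη => hB.norm_fderiv_gradient_le x (Metric.ball_subset_closedBall hη))
      (hB.integrable_fderiv_gradient.norm.add (hB.integrable_lipschitz.abs.mul_const r))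
      (.of_forall fun x η hη =>
        (hB.twiceDifferentiableAt x η (Metric.ball_subset_closedBall hη)).2.hasFDerivAt)
  refine (hderiv.congr_of_eventuallyEq ?_).fderiv
  filter_upwards [hball] with η hη using (hB.hasGradientAt_popRisk hη).gradient

theorem popHess_eq_hess_popRisk (hB : RegularBlock F M Θ θ G c r) :
    popHess F M θ = hess (popRisk F M) θ := by
  ext a b
  simp only [hess, popHess, Matrix.of_apply]
  rw [hB.fderiv_gradient_popRisk, ContinuousLinearMap.integral_apply hB.integrable_fderiv_gradient]
  exact (EuclideanSpace.proj (𝕜 := ℝ) a).integral_comp_comm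
    (hB.integrable_fderiv_gradient.apply_continuousLinearMap _)

theorem integral_fderiv_gradient (hB : RegularBlock F M Θ θ G c r) :
    ∫ x, fderiv ℝ (gradient (M x)) θ ∂F = Matrix.toEuclideanCLM (𝕜 := ℝ) (popHess F M θ) := by
  rw [← hB.fderiv_gradient_popRisk, fderiv_gradient_eq_hess, hB.popHess_eq_hess_popRisk]

theorem mul_norm_sq_le_inner_popHess (hB : RegularBlock F M Θ θ G c r) (h : Param p₁ p₂) :
    c * ‖h‖ ^ 2 ≤ ⟪Matrix.toEuclideanCLM (𝕜 := ℝ) (popHess F M θ) h, h⟫_ℝ := by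
  rw [hB.popHess_eq_hess_popRisk]
  exact mul_norm_sq_le_inner_of_posSemidef_sub hB.posSemidef h

theorem posDef_popHess (hB : RegularBlock F M Θ θ G c r) : (popHess F M θ).PosDef := by
  rw [hB.popHess_eq_hess_popRisk]
  exact posDef_of_posSemidef_sub hB.curvature_pos hB.posSemidef

end RegularBlock

theorem exists_closedBall_subset_of_mem_interior {Θ : Fin K → Set (Param p₁ p₂)}
    {θ : Fin K → Param p₁ p₂} (hθ : ∀ k, θ k ∈ interior (Θ k)) {ρ : ℝ} (hρ : 0 < ρ) :
    ∃ r, 0 < r ∧ r ≤ ρ ∧ ∀ k, Metric.closedBall (θ k) r ⊆ Θ k := by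
  have hev : ∀ k, ∀ᶠ r in 𝓝[>] (0 : ℝ), Metric.closedBall (θ k) r ⊆ Θ k := fun k => by
    obtain ⟨ε, hε, hsub⟩ := Metric.nhds_basis_closedBall.mem_iff.1
      (mem_interior_iff_mem_nhds.1 (hθ k))
    filter_upwards [Ioc_mem_nhdsGT hε] with r hr
    exact (Metric.closedBall_subset_closedBall hr.2).trans hsub
  obtain ⟨r, hr, hr0, hrρ⟩ := ((eventually_all.2 hev).and (Ioc_mem_nhdsGT hρ)).exists
  exact ⟨r, hr0, hrρ, hr⟩

theorem Model.exists_regularBlock {M : Obs d → Param p₁ p₂ → ℝ} {F : Fin K → Measure (Obs d)}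
    {Θ : Fin K → Set (Param p₁ p₂)} {φs : EuclideanSpace ℝ (Fin p₁)}
    {ls : Fin K → EuclideanSpace ℝ (Fin p₂)} {v v₁ : ℝ} (hv : 2 ≤ v) (hv₁ : 2 ≤ v₁)
    (hM : Model M F Θ φs ls v v₁) :
    ∃ (G : Obs d → ℝ) (c r : ℝ), ∀ k, RegularBlock (F k) M (Θ k) (join φs (ls k)) G c r := by
  obtain ⟨c, hc, hcurv⟩ := hM.strong_convexity
  obtain ⟨R, L, G₀, B₀, ρ, G, B, -, -, -, -, hρ, hG, -, hS⟩ := hM.smoothness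
  obtain ⟨r, hr, hrρ, hball⟩ :=
    exists_closedBall_subset_of_mem_interior hM.compactness.interior hρ
  refine ⟨G, c, r, fun k => ?_⟩
  have := hM.prob k
  obtain ⟨htwice, hscore, hhess, hlip, hGmom, -⟩ := hS k
  have hsub : Metric.closedBall (join φs (ls k)) r ⊆ Metric.closedBall (join φs (ls k)) ρ :=
    Metric.closedBall_subset_closedBall hrρ
  have hmoment : ∀ {f : Obs d → ENNReal} {C : ℝ}, ∫⁻ x, f x ^ (2 * v) ∂(F k) ≤ ENNReal.ofReal C →
      ∫⁻ x, f x ∂(F k) < ⊤ := fun hf => by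
    simpa using lintegral_rpow_lt_top_of_le zero_le_one (by linarith)
      (hf.trans_lt ENNReal.ofReal_lt_top)
  exact {
    curvature_pos := hc
    radius_pos := hr
    closedBall_subset := hball k
    convexOn := hM.convex_obj k
    integrable := fun η hη => hM.identifiability.integrable k η (hball k hη)
    isLocalMin := by
      filter_upwards [mem_interior_iff_mem_nhds.1 (hM.compactness.interior k)] with η hη
      rcases eq_or_ne η (join φs (ls k)) with rfl | hne
      · exact le_rfl
      · exact (hM.identifiability.unique_min k η hη hne).le
    posSemidef := (hcurv k).2
    twiceDifferentiableAt := fun x η hη => htwice x η (hsub hη)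
    lintegral_score_lt_top := lintegral_rpow_lt_top_of_le zero_le_two (by linarith)
      (hscore.trans_lt ENNReal.ofReal_lt_top)
    lintegral_hess_lt_top := lintegral_enorm_lt_top_of_sub_const _ (hmoment hhess)
    norm_hess_sub_le := fun x η hη =>
      (hlip x η (hsub hη) _ (Metric.mem_closedBall_self hρ.le)).1
    integrable_lipschitz := ⟨hG.aestronglyMeasurable, hmoment hGmom⟩ }

/-! ### Convergence in probability and in distribution -/

section Convergence

variable {Ω : Type*} [MeasurableSpace Ω] {P : Measure Ω}

theorem tendstoInMeasure_mul_of_integral_norm_le [IsFiniteMeasure P] {ξ Z : ℕ → Ω → ℝ} {C : ℝ}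
    (hξ : TendstoInMeasure P ξ atTop 0) (hZ : ∀ m, Integrable (Z m) P)
    (hC : ∀ m, ∫ ω, ‖Z m ω‖ ∂P ≤ C) :
    TendstoInMeasure P (fun m ω => ξ m ω * Z m ω) atTop 0 := by
  rw [tendstoInMeasure_iff_measureReal_norm] at hξ ⊢
  simp only [Pi.zero_apply, sub_zero, norm_mul] at hξ ⊢
  refine fun ε hε => tendsto_order.2
    ⟨fun a ha => .of_forall fun m => ha.trans_le measureReal_nonneg, fun a ha => ?_⟩
  obtain ⟨T, hCT, hT⟩ : ∃ T, C / T < a / 2 ∧ 0 < T :=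
    (((tendsto_const_nhds.div_atTop tendsto_id).eventually_lt_const (half_pos ha)).and
      (eventually_gt_atTop 0)).exists
  have hmarkov : ∀ m, P.real {ω | T ≤ ‖Z m ω‖} ≤ C / T := fun m => by
    rw [le_div_iff₀' hT]
    exact (mul_meas_ge_le_integral_of_nonneg (.of_forall fun ω => norm_nonneg _)
      (hZ m).norm T).trans (hC m)
  filter_upwards [(hξ (ε / T) (div_pos hε hT)).eventually_lt_const (half_pos ha)] with m hm
  have hcover : {ω | ε ≤ ‖ξ m ω‖ * ‖Z m ω‖} ⊆ {ω | ε / T ≤ ‖ξ m ω‖} ∪ {ω | T ≤ ‖Z m ω‖} := by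
    intro ω (hω : ε ≤ ‖ξ m ω‖ * ‖Z m ω‖)
    by_contra! hsmall
    simp only [Set.mem_union, Set.mem_ofPred_eq, not_or, not_le] at hsmall
    have hprod := mul_lt_mul'' hsmall.1 hsmall.2 (norm_nonneg _) (norm_nonneg _)
    rw [div_mul_cancel₀ _ hT.ne'] at hprod
    exact hω.not_gt hprod
  calc P.real {ω | ε ≤ ‖ξ m ω‖ * ‖Z m ω‖}
      ≤ P.real {ω | ε / T ≤ ‖ξ m ω‖} + P.real {ω | T ≤ ‖Z m ω‖} :=
        (measureReal_mono hcover).trans (measureReal_union_le _ _)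
    _ < a := by linarith [hmarkov m]

theorem tendstoInMeasure_zero_of_ae_isLittleO [IsFiniteMeasure P] {R Z : ℕ → Ω → ℝ} {C : ℝ}
    (hR : ∀ m, AEStronglyMeasurable (R m) P) (hZ : ∀ m, Integrable (Z m) P)
    (hC : ∀ m, ∫ ω, ‖Z m ω‖ ∂P ≤ C)
    (hRZ : ∀ᵐ ω ∂P, (fun m => R m ω) =o[atTop] fun m => Z m ω) :
    TendstoInMeasure P R atTop 0 := by
  have hpos : ∀ m ω, 0 < 1 + ‖Z m ω‖ := fun m ω => by positivity
  have hint : ∀ m, Integrable (fun ω => 1 + ‖Z m ω‖) P := fun m =>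
    (integrable_const 1).add (hZ m).norm
  have hratio : TendstoInMeasure P (fun m ω => R m ω / (1 + ‖Z m ω‖)) atTop 0 := by
    refine tendstoInMeasure_of_tendsto_ae
      (fun m => ((hR m).aemeasurable.div (hint m).aemeasurable).aestronglyMeasurable) ?_
    filter_upwards [hRZ] with ω hω
    refine (hω.trans_le fun m => ?_).tendsto_div_nhds_zero
    rw [Real.norm_of_nonneg (hpos m ω).le]
    linarith
  refine (tendstoInMeasure_mul_of_integral_norm_le (C := P.real Set.univ + C) hratio hint
    fun m => ?_).congr_left fun m => .of_forall fun ω => div_mul_cancel₀ _ (hpos m ω).ne'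
  simp_rw [Real.norm_of_nonneg (hpos m _).le]
  rw [integral_add (integrable_const 1) (hZ m).norm, integral_const, smul_eq_mul, mul_one]
  exact add_le_add_right (hC m) _

theorem charFun_map_inner {E : Type*} [NormedAddCommGroup E] [InnerProductSpace ℝ E]
    [MeasurableSpace E] [BorelSpace E] [SecondCountableTopology E] {S : Ω → E}
    (hS : AEMeasurable S P) (v : E) :
    charFun (P.map S) v = charFun (P.map fun ω => ⟪S ω, v⟫_ℝ) 1 := by
  have hinner : AEMeasurable (fun ω => ⟪S ω, v⟫_ℝ) P :=
    (continuous_id.inner continuous_const).measurable.comp_aemeasurable hS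
  rw [charFun_apply, charFun_apply, integral_map hS (by fun_prop),
    integral_map hinner (by fun_prop)]
  simp

theorem charFun_map_sum_sum_eq_prod {ι κ : Type*} [Fintype ι] {Y : ι → κ → Ω → ℝ}
    (hY : ∀ k i, AEMeasurable (Y k i) P) (hindep : iIndepFun (fun q : ι × κ => Y q.1 q.2) P)
    (s : ι → Finset κ) (t : ℝ) :
    charFun (P.map fun ω => ∑ k, ∑ i ∈ s k, Y k i ω) t
      = ∏ k, charFun (P.map fun ω => ∑ i ∈ s k, Y k i ω) t := by
  have hsigma : iIndepFun (fun (q : (_ : ι) × κ) => Y q.1 q.2) P :=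
    hindep.precomp (Equiv.sigmaEquivProd ι κ).injective
  have hall := (hsigma.restrict (Finset.univ.sigma s)).charFun_map_fun_finsetSum_eq_prod
    fun q _ => hY q.1 q.2
  have hblock : ∀ k, charFun (P.map fun ω => ∑ i ∈ s k, Y k i ω)
      = ∏ i ∈ s k, charFun (P.map (Y k i)) := fun k =>
    ((hindep.precomp (Prod.mk_right_injective k)).restrict (s k)).charFun_map_fun_finsetSum_eq_prod
      fun i _ => hY k i
  simp_rw [Finset.sum_sigma] at hall
  rw [hall, Finset.prod_sigma, Finset.prod_apply]
  simp_rw [hblock]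

variable [IsProbabilityMeasure P]

theorem tendstoInDistribution_id_of_hasLaw {E Ω' : Type*} [TopologicalSpace E] [MeasurableSpace E]
    [OpensMeasurableSpace E] [MeasurableSpace Ω'] {P' : Measure Ω'} [IsProbabilityMeasure P']
    {S : ℕ → Ω → E} {Z : Ω' → E} {ν : Measure E} [IsProbabilityMeasure ν] (hZ : HasLaw Z ν P')
    (hS : TendstoInDistribution S atTop Z (fun _ => P) P') :
    TendstoInDistribution S atTop id (fun _ => P) ν where
  forall_aemeasurable := hS.forall_aemeasurable
  tendsto := by simpa only [hZ.map_eq, Measure.map_id] using hS.tendsto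

theorem tendstoInDistribution_multivariateGaussian {ι : Type*} [Fintype ι] [DecidableEq ι]
    {S : ℕ → Ω → EuclideanSpace ℝ ι} {C : Matrix ι ι ℝ} (hC : C.PosSemidef)
    (hS : ∀ m, AEMeasurable (S m) P)
    (hproj : ∀ v : EuclideanSpace ℝ ι, TendstoInDistribution (fun m ω => ⟪S m ω, v⟫_ℝ) atTop id
      (fun _ => P) (gaussianReal 0 (v ⬝ᵥ C.mulVec v).toNNReal)) :
    TendstoInDistribution S atTop id (fun _ => P) (multivariateGaussian 0 C) where
  forall_aemeasurable := hS
  tendsto := by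
    refine ProbabilityMeasure.tendsto_iff_tendsto_charFun.2 fun v => ?_
    have hv : 0 ≤ v ⬝ᵥ C.mulVec v := by simpa using hC.dotProduct_mulVec_nonneg v
    have hlim := ProbabilityMeasure.tendsto_iff_tendsto_charFun.1 (hproj v).tendsto 1
    simp only [ProbabilityMeasure.coe_mk, Measure.map_id] at hlim ⊢
    rw [charFun_gaussianReal, Real.coe_toNNReal _ hv] at hlim
    simp_rw [charFun_map_inner (hS _), charFun_multivariateGaussian hC]
    simpa using hlim

theorem tendstoInDistribution_inv_sqrt_mul_sum_of_ratio {Y : ℕ → Ω → ℝ} {n : ℕ → ℕ} {N : ℕ → ℝ}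
    {γ : ℝ} (hn : Tendsto n atTop atTop) (hγ : 0 ≤ γ)
    (hratio : Tendsto (fun m => n m / N m) atTop (𝓝 γ)) (hY : MemLp (Y 0) 2 P)
    (hmean : ∫ ω, Y 0 ω ∂P = 0) (hindep : iIndepFun Y P)
    (hident : ∀ i, IdentDistrib (Y i) (Y 0) P P) :
    TendstoInDistribution (fun m ω => (√(N m))⁻¹ * ∑ i ∈ Finset.range (n m), Y i ω) atTop id
      (fun _ => P) (gaussianReal 0 (γ * Var[Y 0; P]).toNNReal) := by
  have hclt := tendstoInDistribution_inv_sqrt_mul_sum_sub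
    (P' := gaussianReal 0 Var[Y 0; P].toNNReal) HasLaw.id hY hindep hident
  simp only [hmean, mul_zero, sub_zero] at hclt
  have hsub : TendstoInDistribution (fun m ω => (√(n m : ℝ))⁻¹ * ∑ i ∈ Finset.range (n m), Y i ω)
      atTop id (fun _ => P) (gaussianReal 0 Var[Y 0; P].toNNReal) :=
    ⟨fun m => hclt.forall_aemeasurable _, hclt.aemeasurable_limit, hclt.tendsto.comp hn⟩
  have hscale : TendstoInMeasure P (fun m (_ : Ω) => √(n m / N m)) atTop (fun _ => √γ) :=
    tendstoInMeasure_of_tendsto_ae (fun m => aestronglyMeasurable_const)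
      (.of_forall fun _ => hratio.sqrt)
  have hslutsky := hsub.continuous_comp_prodMk_of_tendstoInMeasure_const
    (g := fun x : ℝ × ℝ => x.2 * x.1) (by fun_prop) hscale (fun m => aemeasurable_const)
  have hlaw : HasLaw (fun x => √γ * id x) (gaussianReal 0 (γ * Var[Y 0; P]).toNNReal)
      (gaussianReal 0 Var[Y 0; P].toNNReal) := by
    convert gaussianReal_const_mul (HasLaw.id (μ := gaussianReal 0 Var[Y 0; P].toNNReal)) √γ using 2
    · simp
    · rw [Real.toNNReal_mul hγ]
      congr 1
      exact NNReal.eq (by simp [Real.sq_sqrt hγ, hγ])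
  refine (tendstoInDistribution_id_of_hasLaw hlaw hslutsky).congr
    (fun m => .of_forall fun ω => ?_) .rfl
  rcases Nat.eq_zero_or_pos (n m) with h0 | hpos
  · simp [h0]
  · have hsqrt : √(n m : ℝ) ≠ 0 := (Real.sqrt_pos.2 (by exact_mod_cast hpos)).ne'
    simp only [Real.sqrt_div (Nat.cast_nonneg (n m))]
    field_simp

end Convergence

section SecondMoment

variable {Ω : Type*} [MeasurableSpace Ω] {P : Measure Ω}
  {E : Type*} [NormedAddCommGroup E]

theorem integral_norm_le_one_add_integral_norm_sq [IsProbabilityMeasure P] {f : Ω → E}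
    (hf : MemLp f 2 P) : ∫ ω, ‖f ω‖ ∂P ≤ 1 + ∫ ω, ‖f ω‖ ^ 2 ∂P := by
  have hsq : Integrable (fun ω => ‖f ω‖ ^ 2) P := hf.integrable_norm_pow two_ne_zero
  calc ∫ ω, ‖f ω‖ ∂P ≤ ∫ ω, (1 + ‖f ω‖ ^ 2) ∂P :=
        integral_mono (hf.integrable one_le_two).norm ((integrable_const 1).add hsq)
          fun ω => by nlinarith [sq_nonneg (‖f ω‖ - 1)]
    _ = 1 + ∫ ω, ‖f ω‖ ^ 2 ∂P := by
        rw [integral_add (integrable_const 1) hsq]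
        simp

theorem integral_norm_sq_sum_of_pairwise_indepFun [InnerProductSpace ℝ E] [CompleteSpace E]
    [MeasurableSpace E] [BorelSpace E] [IsFiniteMeasure P] {ι : Type*} {Y : ι → Ω → E}
    (hY : ∀ i, MemLp (Y i) 2 P) (hmean : ∀ i, ∫ ω, Y i ω ∂P = 0)
    (hindep : Pairwise fun i j => IndepFun (Y i) (Y j) P) (s : Finset ι) :
    ∫ ω, ‖∑ i ∈ s, Y i ω‖ ^ 2 ∂P = ∑ i ∈ s, ∫ ω, ‖Y i ω‖ ^ 2 ∂P := by
  have hint : ∀ i j, Integrable (fun ω => ⟪Y i ω, Y j ω⟫_ℝ) P := fun i j =>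
    ((hY i).norm.integrable_mul (hY j).norm).mono' ((hY i).1.inner (hY j).1)
      (.of_forall fun ω => norm_inner_le_norm _ _)
  have hcross : ∀ i j, i ≠ j → ∫ ω, ⟪Y i ω, Y j ω⟫_ℝ ∂P = 0 := fun i j hij => by
    refine ((hindep hij).integral_bilin ((hY i).integrable one_le_two)
      ((hY j).integrable one_le_two) (innerSL ℝ)).trans ?_
    rw [hmean i, map_zero, zero_apply]
  calc ∫ ω, ‖∑ i ∈ s, Y i ω‖ ^ 2 ∂P = ∫ ω, ∑ i ∈ s, ∑ j ∈ s, ⟪Y i ω, Y j ω⟫_ℝ ∂P := by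
        simp_rw [← real_inner_self_eq_norm_sq, sum_inner, inner_sum]
    _ = ∑ i ∈ s, ∑ j ∈ s, ∫ ω, ⟪Y i ω, Y j ω⟫_ℝ ∂P := by
        rw [integral_finsetSum _ fun i _ => integrable_finsetSum _ fun j _ => hint i j]
        exact Finset.sum_congr rfl fun i _ => integral_finsetSum _ fun j _ => hint i j
    _ = ∑ i ∈ s, ∫ ω, ‖Y i ω‖ ^ 2 ∂P := by
        refine Finset.sum_congr rfl fun i hi => ?_
        rw [Finset.sum_eq_single_of_mem i hi fun j _ hji => hcross i j hji.symm]
        simp_rw [real_inner_self_eq_norm_sq]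

end SecondMoment

/-! ### Limit theorems for the sample -/

/-- The total sample size `N` of the `m`-th experiment, as a real number. -/
noncomputable abbrev totalSize (n : ℕ → Fin K → ℕ) (m : ℕ) : ℝ := ((∑ k, n m k : ℕ) : ℝ)

namespace SampleSizes

variable {n : ℕ → Fin K → ℕ} {γ : Fin K → ℝ}

theorem tendsto_totalSize (hn : SampleSizes n γ) : Tendsto (totalSize n) atTop atTop :=
  tendsto_natCast_atTop_atTop.comp hn.total_tendsto

theorem tendsto_size (hn : SampleSizes n γ) (k : Fin K) :
    Tendsto (fun m => n m k) atTop atTop := by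
  refine tendsto_natCast_atTop_iff (R := ℝ) |>.1 ?_
  refine ((hn.ratio_tendsto k).pos_mul_atTop (hn.limit_pos k) hn.tendsto_totalSize).congr' ?_
  filter_upwards [hn.tendsto_totalSize.eventually_gt_atTop 0] with m hm
  exact div_mul_cancel₀ _ hm.ne'

theorem nonempty (hn : SampleSizes n γ) : Nonempty (Fin K) := by
  by_contra! hK
  obtain ⟨m, hm⟩ := (hn.total_tendsto.eventually_gt_atTop 0).exists
  simp at hm

theorem exists_pos_le (hn : SampleSizes n γ) : ∃ γ₀, 0 < γ₀ ∧ ∀ k, γ₀ ≤ γ k := by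
  have := hn.nonempty
  obtain ⟨k₀, hk₀⟩ := Finite.exists_min γ
  exact ⟨γ k₀, hn.limit_pos k₀, hk₀⟩

end SampleSizes

namespace IsSample

variable {Ω : Type*} [MeasurableSpace Ω] {P : Measure Ω} {X : Fin K → ℕ → Ω → Obs d}
  {F : Fin K → Measure (Obs d)} {n : ℕ → Fin K → ℕ} {γ : Fin K → ℝ}

section Transfer

variable {B : Type*} [MeasurableSpace B]

theorem aemeasurable_comp (hX : IsSample P X F) {f : Obs d → B} (k : Fin K)
    (hf : AEMeasurable f (F k)) (i : ℕ) : AEMeasurable (fun ω => f (X k i ω)) P :=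
  ((hX.law k i).map_eq ▸ hf).comp_aemeasurable (hX.law k i).aemeasurable

theorem iIndepFun_comp (hX : IsSample P X F) {f : Fin K → Obs d → B}
    (hf : ∀ k, AEMeasurable (f k) (F k)) :
    iIndepFun (fun (q : Fin K × ℕ) ω => f q.1 (X q.1 q.2 ω)) P :=
  hX.indep.comp₀ (fun q => f q.1) (fun q => (hX.law q.1 q.2).aemeasurable)
    fun q => by rw [(hX.law q.1 q.2).map_eq]; exact hf q.1

theorem iIndepFun_block (hX : IsSample P X F) {f : Obs d → B} (k : Fin K)
    (hf : AEMeasurable f (F k)) : iIndepFun (fun (i : ℕ) ω => f (X k i ω)) P :=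
  (hX.indep.precomp (Prod.mk_right_injective k)).comp₀ (fun _ => f)
    (fun i => (hX.law k i).aemeasurable) fun i => by rw [(hX.law k i).map_eq]; exact hf

theorem identDistrib (hX : IsSample P X F) {f : Obs d → B} (k : Fin K)
    (hf : AEMeasurable f (F k)) (i : ℕ) :
    IdentDistrib (fun ω => f (X k i ω)) (fun ω => f (X k 0 ω)) P P :=
  ((hX.law k i).identDistrib (hX.law k 0)).comp_of_aemeasurable (by rwa [(hX.law k i).map_eq])

end Transfer

theorem memLp (hX : IsSample P X F) {B : Type*} [NormedAddCommGroup B] {f : Obs d → B}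
    {p : ENNReal} (k : Fin K) (hf : MemLp f p (F k)) (i : ℕ) :
    MemLp (fun ω => f (X k i ω)) p P :=
  ((hX.law k i).map_eq ▸ hf).comp_of_map (hX.law k i).aemeasurable

theorem memLp_sum (hX : IsSample P X F) {E : Type*} [NormedAddCommGroup E] {f : Obs d → E}
    {p : ENNReal} (k : Fin K) (hf : MemLp f p (F k)) (N : ℕ) :
    MemLp (fun ω => ∑ i ∈ Finset.range N, f (X k i ω)) p P :=
  memLp_finsetSum _ fun i _ => hX.memLp k hf i

theorem strong_law (hX : IsSample P X F) (hn : SampleSizes n γ) {B : Type*}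
    [NormedAddCommGroup B] [NormedSpace ℝ B] [CompleteSpace B] [MeasurableSpace B] [BorelSpace B]
    {f : Obs d → B} (k : Fin K) (hf : Integrable f (F k)) :
    ∀ᵐ ω ∂P, Tendsto (fun m => (totalSize n m)⁻¹ • ∑ i ∈ Finset.range (n m k), f (X k i ω)) atTop
      (𝓝 (γ k • ∫ x, f x ∂F k)) := by
  have hmeas := hf.aestronglyMeasurable.aemeasurable
  have hlaw := strong_law_ae (μ := P) (fun i ω => f (X k i ω))
    (memLp_one_iff_integrable.1 (hX.memLp k (memLp_one_iff_integrable.2 hf) 0))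
    (fun i j hij => (hX.iIndepFun_block k hmeas).indepFun hij) (hX.identDistrib k hmeas)
  have hmean : ∫ ω, f (X k 0 ω) ∂P = ∫ x, f x ∂F k :=
    (hX.law k 0).integral_comp hf.aestronglyMeasurable
  rw [hmean] at hlaw
  filter_upwards [hlaw] with ω hω
  refine ((hn.ratio_tendsto k).smul (hω.comp (hn.tendsto_size k))).congr' ?_
  filter_upwards [(hn.tendsto_size k).eventually_gt_atTop 0] with m hm
  have hsize : (n m k : ℝ) ≠ 0 := by positivity
  rw [Function.comp_apply, smul_smul]
  congr 1
  field_simp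

variable [IsProbabilityMeasure P]

theorem integral_norm_sq_sum (hX : IsSample P X F) {E : Type*} [NormedAddCommGroup E]
    [InnerProductSpace ℝ E] [CompleteSpace E] [MeasurableSpace E] [BorelSpace E]
    {f : Obs d → E} (k : Fin K) (hf : MemLp f 2 (F k)) (hmean : ∫ x, f x ∂F k = 0) (N : ℕ) :
    ∫ ω, ‖∑ i ∈ Finset.range N, f (X k i ω)‖ ^ 2 ∂P = N * ∫ x, ‖f x‖ ^ 2 ∂F k := by
  have hmeas := hf.1.aemeasurable
  rw [integral_norm_sq_sum_of_pairwise_indepFun (hX.memLp k hf)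
    (fun i => ((hX.law k i).integral_comp hf.1).trans hmean)
    (fun i j hij => (hX.iIndepFun_block k hmeas).indepFun hij)]
  have hmoment : ∀ i, ∫ ω, ‖f (X k i ω)‖ ^ 2 ∂P = ∫ x, ‖f x‖ ^ 2 ∂F k := fun i =>
    (hX.law k i).integral_comp (f := fun x => ‖f x‖ ^ 2) (hf.1.norm.pow 2)
  simp [hmoment]

theorem integral_norm_inv_sqrt_smul_sum_le (hX : IsSample P X F) {E : Type*}
    [NormedAddCommGroup E] [InnerProductSpace ℝ E] [CompleteSpace E] [MeasurableSpace E]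
    [BorelSpace E] {f : Obs d → E} (k : Fin K) (hf : MemLp f 2 (F k))
    (hmean : ∫ x, f x ∂F k = 0) (m : ℕ) :
    ∫ ω, ‖(√(totalSize n m))⁻¹ • ∑ i ∈ Finset.range (n m k), f (X k i ω)‖ ∂P ≤
      1 + ∫ x, ‖f x‖ ^ 2 ∂F k := by
  have hsize : (n m k : ℝ) ≤ totalSize n m := by
    exact_mod_cast Finset.single_le_sum (fun j _ => Nat.zero_le (n m j)) (Finset.mem_univ k)
  calc _ ≤ 1 + ∫ ω, ‖(√(totalSize n m))⁻¹ • ∑ i ∈ Finset.range (n m k), f (X k i ω)‖ ^ 2 ∂P :=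
        integral_norm_le_one_add_integral_norm_sq ((hX.memLp_sum k hf (n m k)).const_smul _)
    _ = 1 + (n m k / totalSize n m) * ∫ x, ‖f x‖ ^ 2 ∂F k := by
        simp_rw [norm_smul, mul_pow, integral_const_mul, hX.integral_norm_sq_sum k hf hmean,
          norm_inv, Real.norm_of_nonneg (Real.sqrt_nonneg _), inv_pow,
          Real.sq_sqrt (Nat.cast_nonneg _)]
        ring
    _ ≤ 1 + ∫ x, ‖f x‖ ^ 2 ∂F k := by
        gcongr
        exact mul_le_of_le_one_left (integral_nonneg fun x => by positivity)
          (div_le_one_of_le₀ hsize (Nat.cast_nonneg _))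

theorem tendstoInDistribution_block (hX : IsSample P X F) (hn : SampleSizes n γ) {f : Obs d → ℝ}
    (k : Fin K) (hf : MemLp f 2 (F k)) (hmean : ∫ x, f x ∂F k = 0) :
    TendstoInDistribution (fun m ω => (√(totalSize n m))⁻¹ *
      ∑ i ∈ Finset.range (n m k), f (X k i ω)) atTop id (fun _ => P)
      (gaussianReal 0 (γ k * Var[f; F k]).toNNReal) := by
  have hmeas := hf.1.aemeasurable
  have hvar : Var[fun ω => f (X k 0 ω); P] = Var[f; F k] := by
    rw [← (hX.law k 0).map_eq]
    exact (variance_map ((hX.law k 0).map_eq ▸ hmeas) (hX.law k 0).aemeasurable).symm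
  rw [← hvar]
  exact tendstoInDistribution_inv_sqrt_mul_sum_of_ratio (hn.tendsto_size k) (hn.limit_pos k).le
    (hn.ratio_tendsto k) (hX.memLp k hf 0) (((hX.law k 0).integral_comp hf.1).trans hmean)
    (hX.iIndepFun_block k hmeas) (hX.identDistrib k hmeas)

theorem tendstoInDistribution_sum (hX : IsSample P X F) (hn : SampleSizes n γ)
    {f : Fin K → Obs d → ℝ} (hf : ∀ k, MemLp (f k) 2 (F k))
    (hmean : ∀ k, ∫ x, f k x ∂F k = 0) :
    TendstoInDistribution (fun m ω => (√(totalSize n m))⁻¹ *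
      ∑ k, ∑ i ∈ Finset.range (n m k), f k (X k i ω)) atTop id (fun _ => P)
      (gaussianReal 0 (∑ k, γ k * Var[f k; F k]).toNNReal) := by
  have hmeas : ∀ k i, AEMeasurable (fun ω => f k (X k i ω)) P := fun k =>
    hX.aemeasurable_comp k (hf k).1.aemeasurable
  have hblock : ∀ m k, AEMeasurable (fun ω => ∑ i ∈ Finset.range (n m k), f k (X k i ω)) P :=
    fun m k => Finset.aemeasurable_fun_sum _ fun i _ => hmeas k i
  have hsum : ∀ m, AEMeasurable (fun ω => ∑ k, ∑ i ∈ Finset.range (n m k), f k (X k i ω)) P :=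
    fun m => Finset.aemeasurable_fun_sum _ fun k _ => hblock m k
  have hnonneg : ∀ k, 0 ≤ γ k * Var[f k; F k] := fun k =>
    mul_nonneg (hn.limit_pos k).le (variance_nonneg _ _)
  refine ⟨fun m => (hsum m).const_mul _, aemeasurable_id, ?_⟩
  refine ProbabilityMeasure.tendsto_iff_tendsto_charFun.2 fun t => ?_
  have hlim : charFun (gaussianReal 0 (∑ k, γ k * Var[f k; F k]).toNNReal) t
      = ∏ k, charFun (gaussianReal 0 (γ k * Var[f k; F k]).toNNReal) t := by
    simp_rw [charFun_gaussianReal, ← Complex.exp_sum, Real.coe_toNNReal _ (hnonneg _),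
      Real.coe_toNNReal _ (Finset.sum_nonneg fun k _ => hnonneg k)]
    simp [Finset.sum_div, Finset.sum_mul]
  have hfactor : ∀ k, Tendsto (fun m => charFun (P.map fun ω => (√(totalSize n m))⁻¹ *
      ∑ i ∈ Finset.range (n m k), f k (X k i ω)) t) atTop
      (𝓝 (charFun (gaussianReal 0 (γ k * Var[f k; F k]).toNNReal) t)) := fun k => by
    simpa only [ProbabilityMeasure.coe_mk, Measure.map_id] using
      ProbabilityMeasure.tendsto_iff_tendsto_charFun.1
        (hX.tendstoInDistribution_block hn k (hf k) (hmean k)).tendsto t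
  simp only [ProbabilityMeasure.coe_mk, Measure.map_id, hlim]
  refine (tendsto_finsetProd Finset.univ fun k _ => hfactor k).congr fun m => ?_
  rw [charFun_map_mul_comp (hsum m), charFun_map_sum_sum_eq_prod hmeas
    (hX.iIndepFun_comp fun k => (hf k).1.aemeasurable)]
  simp_rw [charFun_map_mul_comp (hblock m _)]

end IsSample

/-! ### Linearization of the estimators -/

section Linearization

/-- The gradient `∑_{i=1}^{n} ∇M(x_i; θ)` of the empirical objective `empObj M x n`. -/
noncomputable def scoreSum (M : Obs d → Param p₁ p₂ → ℝ) (x : ℕ → Obs d) (n : ℕ)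
    (θ : Param p₁ p₂) : Param p₁ p₂ :=
  ∑ i ∈ Finset.range n, gradient (M (x i)) θ

theorem RegularBlock.convexExpansion_empObj {F : Measure (Obs d)} {M : Obs d → Param p₁ p₂ → ℝ}
    {Θ : Set (Param p₁ p₂)} {θ : Param p₁ p₂} {G : Obs d → ℝ} {c r : ℝ}
    (hB : RegularBlock F M Θ θ G c r) (x : ℕ → Obs d) (n : ℕ) :
    ConvexExpansion Θ θ r (empObj M x n) (scoreSum M x n)
      (∑ i ∈ Finset.range n, fderiv ℝ (gradient (M (x i))) θ)
      (∑ i ∈ Finset.range n, |G (x i)|) := by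
  have hsum := ConvexExpansion.sum (s := Finset.range n) hB.closedBall_subset (hB.convexOn 0).1
    fun i _ => hB.convexExpansion (x i)
  have hobj : empObj M x n = ∑ i ∈ Finset.range n, M (x i) := by
    ext η; simp [empObj]
  have hscore : scoreSum M x n = ∑ i ∈ Finset.range n, gradient (M (x i)) :=
    funext fun η => by rw [scoreSum, Finset.sum_apply]
  rwa [hobj, hscore]

variable {Ω : Type*} [MeasurableSpace Ω] {P : Measure Ω} {X : Fin K → ℕ → Ω → Obs d}
  {F : Fin K → Measure (Obs d)} {M : Obs d → Param p₁ p₂ → ℝ} {Θ : Fin K → Set (Param p₁ p₂)}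
  {θ : Fin K → Param p₁ p₂} {n : ℕ → Fin K → ℕ} {γ : Fin K → ℝ} {G : Fin K → Obs d → ℝ} {c r : ℝ}
  {q : ℕ → Fin K → ℝ} {V : Submodule ℝ (Fin K → Param p₁ p₂)}
  {δ : ℕ → Ω → Fin K → Param p₁ p₂}

theorem IsSample.integrable_smul_scoreSum [IsFiniteMeasure P] (hX : IsSample P X F) {k : Fin K}
    {η : Param p₁ p₂} (hM : MemLp (fun x => gradient (M x) η) 2 (F k)) (a : ℝ) (N : ℕ) :
    Integrable (fun ω => a • scoreSum M (fun i => X k i ω) N η) P :=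
  ((hX.memLp_sum k hM N).const_smul a).integrable one_le_two

variable [∀ k, IsFiniteMeasure (F k)]

theorem ae_isLittleO_argmin_linearization
    (hB : ∀ k, RegularBlock (F k) M (Θ k) (θ k) (G k) c r) (hn : SampleSizes n γ)
    (hX : IsSample P X F) (hq : ∀ k, Tendsto (fun m => q m k) atTop (𝓝 (γ k)))
    (hδ : ∀ m, ∀ᵐ ω ∂P, IsArgminDisplacement V Θ θ
      (fun k => empObj M (fun i => X k i ω) (n m k)) (δ m ω))
    {h : Fin K → Param p₁ p₂} (hh : h ∈ V) :
    ∀ᵐ ω ∂P, (fun m => ∑ k,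
        ⟪q m k • Matrix.toEuclideanCLM (𝕜 := ℝ) (popHess (F k) M (θ k)) (δ m ω k)
          + (totalSize n m)⁻¹ • scoreSum M (fun i => X k i ω) (n m k) (θ k), h k⟫_ℝ)
      =o[atTop] fun m => ∑ k,
        ‖(totalSize n m)⁻¹ • scoreSum M (fun i => X k i ω) (n m k) (θ k)‖ := by
  obtain ⟨k₀⟩ := hn.nonempty
  obtain ⟨γ₀, hγ₀, hγ⟩ := hn.exists_pos_le
  have hslope := ae_all_iff.2 fun k => hX.strong_law hn k (hB k).integrable_fderiv_gradient
  have hlipschitz := ae_all_iff.2 fun k => hX.strong_law hn k (hB k).integrable_lipschitz.abs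
  have hscore := ae_all_iff.2 fun k => hX.strong_law hn k (hB k).integrable_score
  simp only [(hB _).integral_fderiv_gradient] at hslope
  simp only [(hB _).integral_score, smul_zero] at hscore
  filter_upwards [hslope, hlipschitz, hscore, ae_all_iff.2 hδ] with ω hslope hlipschitz hscore hδ
  have hN : ∀ m, 0 ≤ (totalSize n m)⁻¹ := fun m => by positivity
  exact isLittleO_argmin_linearization (hB k₀).radius_pos (mul_pos hγ₀ (hB k₀).curvature_pos)
    (H := fun k => γ k • Matrix.toEuclideanCLM (𝕜 := ℝ) (popHess (F k) M (θ k)))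
    (Q := fun m k => q m k • Matrix.toEuclideanCLM (𝕜 := ℝ) (popHess (F k) M (θ k)))
    (δ := fun m => δ m ω)
    (fun m k => ((hB k).convexExpansion_empObj (fun i => X k i ω) (n m k)).const_smul (hN m))
    (fun k u => mul_mul_norm_sq_le_inner_smul (hn.limit_pos k).le (hγ k) (hB k).curvature_pos.le
      ((hB k).mul_norm_sq_le_inner_popHess u))
    hslope (fun k => (hq k).smul_const _) hlipschitz hscore (fun m => (hδ m).const_smul (hN m)) hh

variable [IsProbabilityMeasure P]

theorem integral_sum_norm_scoreSum_le (hB : ∀ k, RegularBlock (F k) M (Θ k) (θ k) (G k) c r)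
    (hX : IsSample P X F) (m : ℕ) :
    ∫ ω, ∑ k, ‖(√(totalSize n m))⁻¹ • scoreSum M (fun i => X k i ω) (n m k) (θ k)‖ ∂P ≤
      ∑ k, (1 + ∫ x, ‖gradient (M x) (θ k)‖ ^ 2 ∂F k) := by
  rw [integral_finsetSum _ fun k _ =>
    (hX.integrable_smul_scoreSum (hB k).memLp_score (√(totalSize n m))⁻¹ (n m k)).norm]
  exact Finset.sum_le_sum fun k _ =>
    hX.integral_norm_inv_sqrt_smul_sum_le k (hB k).memLp_score (hB k).integral_score m

theorem tendstoInMeasure_argmin_linearization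
    (hB : ∀ k, RegularBlock (F k) M (Θ k) (θ k) (G k) c r) (hn : SampleSizes n γ)
    (hX : IsSample P X F) (hq : ∀ k, Tendsto (fun m => q m k) atTop (𝓝 (γ k)))
    (hmeas : ∀ m k, AEMeasurable (fun ω => δ m ω k) P)
    (hδ : ∀ m, ∀ᵐ ω ∂P, IsArgminDisplacement V Θ θ
      (fun k => empObj M (fun i => X k i ω) (n m k)) (δ m ω))
    {h : Fin K → Param p₁ p₂} (hh : h ∈ V) :
    TendstoInMeasure P (fun m ω => ∑ k,
      ⟪(√(totalSize n m) * q m k) •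
          Matrix.toEuclideanCLM (𝕜 := ℝ) (popHess (F k) M (θ k)) (δ m ω k)
        + (√(totalSize n m))⁻¹ • scoreSum M (fun i => X k i ω) (n m k) (θ k), h k⟫_ℝ)
      atTop 0 := by
  have hscale : ∀ m, √(totalSize n m) * (totalSize n m)⁻¹ = (√(totalSize n m))⁻¹ := fun m => by
    rw [← div_eq_mul_inv, Real.sqrt_div_self', one_div]
  have hint : ∀ m k, Integrable (fun ω =>
      (√(totalSize n m))⁻¹ • scoreSum M (fun i => X k i ω) (n m k) (θ k)) P := fun m k =>
    hX.integrable_smul_scoreSum (hB k).memLp_score _ _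
  refine tendstoInMeasure_zero_of_ae_isLittleO (fun m => ?_)
    (fun m => integrable_finsetSum Finset.univ fun k _ => (hint m k).norm)
    (fun m => ?_) ?_ (C := ∑ k, (1 + ∫ x, ‖gradient (M x) (θ k)‖ ^ 2 ∂F k))
  · refine Finset.aestronglyMeasurable_fun_sum _ fun k _ =>
      AEStronglyMeasurable.inner (.add ?_ (hint m k).1) aestronglyMeasurable_const
    exact (ContinuousLinearMap.continuous ((√(totalSize n m) * q m k) •
      Matrix.toEuclideanCLM (𝕜 := ℝ) (popHess (F k) M (θ k)))).comp_aestronglyMeasurable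
        (hmeas m k).aestronglyMeasurable
  · simp_rw [Real.norm_of_nonneg (Finset.sum_nonneg fun _ _ => norm_nonneg _)]
    exact integral_sum_norm_scoreSum_le hB hX m
  · filter_upwards [ae_isLittleO_argmin_linearization hB hn hX hq hδ hh] with ω hω
    refine ((Asymptotics.isBigO_refl (fun m => √(totalSize n m)) atTop).mul_isLittleO hω).congr
      (fun m => ?_) fun m => ?_
    · simp_rw [Finset.mul_sum, ← real_inner_smul_left, smul_add, smul_smul, hscale]
    · simp_rw [Finset.mul_sum, norm_smul, ← mul_assoc, norm_inv,
        Real.norm_of_nonneg (Real.sqrt_nonneg _), Real.norm_of_nonneg (Nat.cast_nonneg _), hscale]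

end Linearization

/-! ### Schur complements -/

section Schur

theorem dotProduct_mulVec_comm_of_isHermitian {ι : Type*} [Fintype ι] {A : Matrix ι ι ℝ}
    (hA : A.IsHermitian) (x y : ι → ℝ) : x ⬝ᵥ A.mulVec y = A.mulVec x ⬝ᵥ y := by
  rw [Matrix.dotProduct_mulVec, ← Matrix.mulVec_transpose,
    ← Matrix.conjTranspose_eq_transpose_of_trivial, hA.eq]

variable {ι κ : Type*} {A : Matrix (ι ⊕ κ) (ι ⊕ κ) ℝ}

theorem posDef_toBlocks₂₂ (hA : A.PosDef) : A.toBlocks₂₂.PosDef :=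
  hA.submatrix Sum.inr_injective

variable [Fintype κ] [DecidableEq κ]

/-- The Schur complement of the lower right block of `A`; `partialHess F M θ` is the Schur
complement of `popHess F M θ`. -/
noncomputable def schurCompl (A : Matrix (ι ⊕ κ) (ι ⊕ κ) ℝ) : Matrix ι ι ℝ :=
  A.toBlocks₁₁ - A.toBlocks₁₂ * A.toBlocks₂₂⁻¹ * A.toBlocks₂₁

theorem isHermitian_schurCompl (hA : A.IsHermitian) :
    (schurCompl A).IsHermitian := by
  rw [← A.fromBlocks_toBlocks, Matrix.isHermitian_fromBlocks_iff] at hA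
  obtain ⟨h₁₁, h₁₂, -, h₂₂⟩ := hA
  refine h₁₁.sub ?_
  rw [← h₁₂]
  exact Matrix.isHermitian_mul_mul_conjTranspose _ h₂₂.inv

/-- The least favourable direction `(u, -A₂₂⁻¹ A₂₁ u)`: along it, the quadratic form of `A` is
minimal among all directions with first component `u`. -/
noncomputable def schurDir [Fintype ι] (A : Matrix (ι ⊕ κ) (ι ⊕ κ) ℝ) (u : ι → ℝ) :
    EuclideanSpace ℝ (ι ⊕ κ) :=
  WithLp.toLp 2 (Sum.elim u (-(A.toBlocks₂₂⁻¹.mulVec (A.toBlocks₂₁.mulVec u))))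

variable [Fintype ι]

theorem mulVec_schurDir (hA : IsUnit A.toBlocks₂₂) (u : ι → ℝ) :
    A.mulVec (schurDir A u) = Sum.elim ((schurCompl A).mulVec u) 0 := by
  conv_lhs => rw [← A.fromBlocks_toBlocks, Matrix.fromBlocks_mulVec]
  simp only [schurDir, schurCompl, Matrix.fromBlocks_toBlocks, Sum.elim_comp_inl,
    Sum.elim_comp_inr, Matrix.mulVec_neg, Matrix.sub_mulVec, Matrix.mulVec_mulVec]
  rw [← Matrix.mul_assoc A.toBlocks₂₂,
    Matrix.mul_nonsing_inv _ ((Matrix.isUnit_iff_isUnit_det _).1 hA), Matrix.one_mul,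
    add_neg_cancel, Matrix.mul_assoc, ← sub_eq_add_neg]

theorem schurDir_dotProduct (A : Matrix (ι ⊕ κ) (ι ⊕ κ) ℝ) (u w : ι → ℝ) :
    (schurDir A u).ofLp ⬝ᵥ Sum.elim w 0 = u ⬝ᵥ w := by
  simp [schurDir, dotProduct]

theorem posDef_schurCompl {ι : Type*} [Finite ι] {A : Matrix (ι ⊕ κ) (ι ⊕ κ) ℝ}
    (hA : A.PosDef) : (schurCompl A).PosDef := by
  cases nonempty_fintype ι
  refine .of_dotProduct_mulVec_pos (isHermitian_schurCompl hA.isHermitian) fun u hu => ?_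
  have hdir : (schurDir A u).ofLp ≠ 0 := fun h => hu <| funext fun a => congrFun h (Sum.inl a)
  have hpos := hA.dotProduct_mulVec_pos hdir
  rwa [mulVec_schurDir (posDef_toBlocks₂₂ hA).isUnit, star_trivial, schurDir_dotProduct] at hpos

theorem inner_toEuclideanCLM_schurDir [DecidableEq ι] (hA : A.PosDef)
    (x : EuclideanSpace ℝ (ι ⊕ κ)) (u : ι → ℝ) :
    ⟪Matrix.toEuclideanCLM (𝕜 := ℝ) A x, schurDir A u⟫_ℝ
      = (fun a => x (Sum.inl a)) ⬝ᵥ (schurCompl A).mulVec u := by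
  rw [inner_toEuclideanCLM, dotProduct_mulVec_comm_of_isHermitian hA.isHermitian,
    mulVec_schurDir (posDef_toBlocks₂₂ hA).isUnit, dotProduct_comm]
  simp [dotProduct]

theorem inner_schurDir (hA : A.IsHermitian) (g : EuclideanSpace ℝ (ι ⊕ κ)) (u : ι → ℝ) :
    ⟪g, schurDir A u⟫_ℝ = u ⬝ᵥ ((fun a => g (Sum.inl a)) -
      (A.toBlocks₁₂ * A.toBlocks₂₂⁻¹).mulVec fun b => g (Sum.inr b)) := by
  rw [← A.fromBlocks_toBlocks, Matrix.isHermitian_fromBlocks_iff] at hA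
  obtain ⟨-, h₁₂, -, h₂₂⟩ := hA
  have hcross : u ⬝ᵥ ((A.toBlocks₁₂ * A.toBlocks₂₂⁻¹).mulVec fun b => g (Sum.inr b))
      = (A.toBlocks₂₂⁻¹.mulVec (A.toBlocks₂₁.mulVec u)) ⬝ᵥ fun b => g (Sum.inr b) := by
    rw [Matrix.dotProduct_mulVec, ← Matrix.mulVec_transpose,
      ← Matrix.conjTranspose_eq_transpose_of_trivial, Matrix.conjTranspose_mul, h₁₂,
      h₂₂.inv.eq, Matrix.mulVec_mulVec]
  rw [dotProduct_sub, hcross, EuclideanSpace.inner_eq_star_dotProduct]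
  simp [schurDir, dotProduct, sub_eq_add_neg]

end Schur

/-! ### Sandwich covariance matrices -/

section Sandwich

variable {ι : Type*} [Fintype ι] [DecidableEq ι] {A S : Matrix ι ι ℝ}

theorem posSemidef_inv_mul_mul_inv (hA : A.IsHermitian) (hS : S.PosSemidef) :
    (A⁻¹ * S * A⁻¹).PosSemidef := by
  simpa only [hA.inv.eq] using hS.mul_mul_conjTranspose_same A⁻¹

theorem dotProduct_inv_mul_mul_inv_mulVec (hA : A.IsHermitian) (v : ι → ℝ) :
    v ⬝ᵥ (A⁻¹ * S * A⁻¹).mulVec v = (A⁻¹.mulVec v) ⬝ᵥ S.mulVec (A⁻¹.mulVec v) := by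
  rw [Matrix.mul_assoc, ← Matrix.mulVec_mulVec, ← Matrix.mulVec_mulVec,
    dotProduct_mulVec_comm_of_isHermitian hA.inv]

theorem mulVec_inv_mulVec (hA : IsUnit A) (v : ι → ℝ) : A.mulVec (A⁻¹.mulVec v) = v := by
  rw [Matrix.mulVec_mulVec, Matrix.mul_nonsing_inv _ ((Matrix.isUnit_iff_isUnit_det _).1 hA),
    Matrix.one_mulVec]

end Sandwich

theorem variance_dotProduct {ι α : Type*} [Fintype ι] [MeasurableSpace α] {μ : Measure α}
    [IsFiniteMeasure μ] {s : α → ι → ℝ} (hs : ∀ a, MemLp (fun x => s x a) 2 μ) (u : ι → ℝ) :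
    Var[fun x => u ⬝ᵥ s x; μ] =
      u ⬝ᵥ (Matrix.of fun a b => cov[fun x => s x a, fun x => s x b; μ]).mulVec u := by
  have hmul : ∀ a, MemLp (fun x => u a * s x a) 2 μ := fun a => (hs a).const_mul _
  simp_rw [dotProduct]
  rw [← covariance_self (memLp_finsetSum _ fun a _ => hmul a).1.aemeasurable,
    covariance_fun_sum_fun_sum hmul hmul]
  simp_rw [covariance_const_mul_left, covariance_const_mul_right, Matrix.mulVec, dotProduct,
    Finset.mul_sum, Matrix.of_apply]
  exact Finset.sum_congr rfl fun a _ => Finset.sum_congr rfl fun b _ => by ring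

namespace RegularBlock

variable {F : Measure (Obs d)} {M : Obs d → Param p₁ p₂ → ℝ} {Θ : Set (Param p₁ p₂)}
  {θ : Param p₁ p₂} {G : Obs d → ℝ} {c r : ℝ}
  [IsFiniteMeasure F]

theorem posDef_partialHess (hB : RegularBlock F M Θ θ G c r) : (partialHess F M θ).PosDef :=
  posDef_schurCompl hB.posDef_popHess

theorem inner_score_schurDir (hB : RegularBlock F M Θ θ G c r) (x : Obs d) (u : Fin p₁ → ℝ) :
    ⟪gradient (M x) θ, schurDir (popHess F M θ) u⟫_ℝ = u ⬝ᵥ adjScore F M θ x :=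
  inner_schurDir hB.posDef_popHess.isHermitian _ u

theorem inner_popHess_schurDir (hB : RegularBlock F M Θ θ G c r) (δ : Param p₁ p₂)
    (u : Fin p₁ → ℝ) :
    ⟪Matrix.toEuclideanCLM (𝕜 := ℝ) (popHess F M θ) δ, schurDir (popHess F M θ) u⟫_ℝ
      = common δ ⬝ᵥ (partialHess F M θ).mulVec u :=
  inner_toEuclideanCLM_schurDir hB.posDef_popHess δ u

theorem memLp_adjScore (hB : RegularBlock F M Θ θ G c r) (a : Fin p₁) :
    MemLp (fun x => adjScore F M θ x a) 2 F := by
  simpa only [hB.inner_score_schurDir, single_one_dotProduct] using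
    hB.memLp_score.inner_const (𝕜 := ℝ) (schurDir (popHess F M θ) (Pi.single a 1))

theorem integral_inner_score (hB : RegularBlock F M Θ θ G c r)
    (u : Param p₁ p₂) : ∫ x, ⟪gradient (M x) θ, u⟫_ℝ ∂F = 0 := by
  simp_rw [real_inner_comm u]
  rw [_root_.integral_inner hB.integrable_score, hB.integral_score, inner_zero_right]

theorem variance_inner_score_schurDir (hB : RegularBlock F M Θ θ G c r) (u : Fin p₁ → ℝ) :
    Var[fun x => ⟪gradient (M x) θ, schurDir (popHess F M θ) u⟫_ℝ; F]
      = u ⬝ᵥ (scoreVar F M θ).mulVec u := by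
  simp_rw [hB.inner_score_schurDir]
  exact variance_dotProduct hB.memLp_adjScore u

theorem posSemidef_scoreVar (hB : RegularBlock F M Θ θ G c r) : (scoreVar F M θ).PosSemidef := by
  refine .of_dotProduct_mulVec_nonneg ?_ fun u => ?_
  · ext a b
    simp [scoreVar, covariance_comm]
  · rw [star_trivial, ← hB.variance_inner_score_schurDir]
    exact variance_nonneg _ _

end RegularBlock

/-! ### Asymptotic normality -/

section Normality

variable {Ω : Type*} [MeasurableSpace Ω] {P : Measure Ω} [IsProbabilityMeasure P]
  {X : Fin K → ℕ → Ω → Obs d} {F : Fin K → Measure (Obs d)} [∀ k, IsFiniteMeasure (F k)]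
  {M : Obs d → Param p₁ p₂ → ℝ} {Θ : Fin K → Set (Param p₁ p₂)} {θ : Fin K → Param p₁ p₂}
  {n : ℕ → Fin K → ℕ} {γ : Fin K → ℝ} {G : Fin K → Obs d → ℝ} {c r : ℝ}

theorem tendstoInDistribution_inner_scoreSum_schurDir
    (hB : ∀ k, RegularBlock (F k) M (Θ k) (θ k) (G k) c r) (hn : SampleSizes n γ)
    (hX : IsSample P X F) (u : Fin K → Fin p₁ → ℝ) :
    TendstoInDistribution (fun m ω => -∑ k,
        ⟪(√(totalSize n m))⁻¹ • scoreSum M (fun i => X k i ω) (n m k) (θ k),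
          schurDir (popHess (F k) M (θ k)) (u k)⟫_ℝ) atTop id (fun _ => P)
      (gaussianReal 0
        (∑ k, γ k * (u k ⬝ᵥ (scoreVar (F k) M (θ k)).mulVec (u k))).toNNReal) := by
  have hlim := hX.tendstoInDistribution_sum hn
    (f := fun k x => -⟪gradient (M x) (θ k), schurDir (popHess (F k) M (θ k)) (u k)⟫_ℝ)
    (fun k => ((hB k).memLp_score.inner_const _).neg)
    (fun k => by rw [integral_neg, (hB k).integral_inner_score, neg_zero])
  simp_rw [variance_fun_neg, (hB _).variance_inner_score_schurDir] at hlim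
  simpa only [scoreSum, real_inner_smul_left, sum_inner, Finset.sum_neg_distrib, mul_neg,
    Finset.mul_sum] using hlim

/-- The directions `schurDir (u v k)` turn the linearized stationarity condition of an argmin
displacement `δ` into a central limit theorem for the projection of `S` on `v`. -/
theorem tendstoInDistribution_of_argmin {q : ℕ → Fin K → ℝ}
    {V : Submodule ℝ (Fin K → Param p₁ p₂)} {δ : ℕ → Ω → Fin K → Param p₁ p₂}
    {S : ℕ → Ω → EuclideanSpace ℝ (Fin p₁)} {C : Matrix (Fin p₁) (Fin p₁) ℝ}
    {u : EuclideanSpace ℝ (Fin p₁) → Fin K → Fin p₁ → ℝ}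
    (hB : ∀ k, RegularBlock (F k) M (Θ k) (θ k) (G k) c r) (hn : SampleSizes n γ)
    (hX : IsSample P X F) (hq : ∀ k, Tendsto (fun m => q m k) atTop (𝓝 (γ k)))
    (hmeas : ∀ m k, AEMeasurable (fun ω => δ m ω k) P)
    (hδ : ∀ m, ∀ᵐ ω ∂P, IsArgminDisplacement V Θ θ
      (fun k => empObj M (fun i => X k i ω) (n m k)) (δ m ω))
    (huV : ∀ v, (fun k => schurDir (popHess (F k) M (θ k)) (u v k)) ∈ V)
    (hS : ∀ m, AEMeasurable (S m) P) (hSδ : ∀ m ω v, ⟪S m ω, v⟫_ℝ = √(totalSize n m) *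
      ∑ k, q m k * (common (δ m ω k) ⬝ᵥ (partialHess (F k) M (θ k)).mulVec (u v k)))
    (hC : C.PosSemidef) (hu : ∀ v : EuclideanSpace ℝ (Fin p₁), v ⬝ᵥ C.mulVec v =
      ∑ k, γ k * (u v k ⬝ᵥ (scoreVar (F k) M (θ k)).mulVec (u v k))) :
    TendstoInDistribution S atTop id (fun _ => P) (multivariateGaussian 0 C) := by
  refine tendstoInDistribution_multivariateGaussian hC hS fun v => ?_
  rw [hu]
  refine tendstoInDistribution_of_tendstoInMeasure_sub _ _
    (tendstoInDistribution_inner_scoreSum_schurDir hB hn hX (u v)) ?_ fun m =>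
      (hS m).inner_const
  refine (tendstoInMeasure_argmin_linearization hB hn hX hq hmeas hδ (huV v)).congr_left
    fun m => .of_forall fun ω => ?_
  simp only [Pi.sub_apply, sub_neg_eq_add, hSδ, inner_add_left, Finset.sum_add_distrib,
    real_inner_smul_left, (hB _).inner_popHess_schurDir, Finset.mul_sum, mul_assoc]

end Normality

/-! ### The split-and-conquer estimator -/

section SaCEstimator

theorem common_sub (θ η : Param p₁ p₂) : common (θ - η) = common θ - common η := rfl

theorem common_join (φ : EuclideanSpace ℝ (Fin p₁)) (l : EuclideanSpace ℝ (Fin p₂)) :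
    common (join φ l) = φ := rfl

theorem measurable_common : Measurable (common : Param p₁ p₂ → EuclideanSpace ℝ (Fin p₁)) := by
  unfold common
  fun_prop

variable {Ω : Type*} {F : Fin K → Measure (Obs d)} {M : Obs d → Param p₁ p₂ → ℝ}
  {Θ : Fin K → Set (Param p₁ p₂)} {θ : Fin K → Param p₁ p₂} {φs : EuclideanSpace ℝ (Fin p₁)}
  {ls : Fin K → EuclideanSpace ℝ (Fin p₂)} {n : ℕ → Fin K → ℕ} {γ : Fin K → ℝ}
  {G : Fin K → Obs d → ℝ} {c r : ℝ} {T : ℕ → Fin K → Ω → Param p₁ p₂}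

theorem posSemidef_covSaC [∀ k, IsFiniteMeasure (F k)]
    (hB : ∀ k, RegularBlock (F k) M (Θ k) (θ k) (G k) c r) (hγ : ∀ k, 0 ≤ γ k) :
    (covSaC F M θ γ).PosSemidef :=
  Matrix.posSemidef_sum _ fun k _ => (posSemidef_inv_mul_mul_inv
    (hB k).posDef_partialHess.isHermitian (hB k).posSemidef_scoreVar).smul (hγ k)

theorem dotProduct_covSaC_mulVec
    (hJ : ∀ k, (partialHess (F k) M (θ k)).IsHermitian) (v : Fin p₁ → ℝ) :
    v ⬝ᵥ (covSaC F M θ γ).mulVec v = ∑ k, γ k * ((partialHess (F k) M (θ k))⁻¹.mulVec v ⬝ᵥ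
      (scoreVar (F k) M (θ k)).mulVec ((partialHess (F k) M (θ k))⁻¹.mulVec v)) := by
  simp_rw [covSaC, Matrix.sum_mulVec, dotProduct_sum, Matrix.smul_mulVec, dotProduct_smul,
    smul_eq_mul, dotProduct_inv_mul_mul_inv_mulVec (hJ _)]

theorem sqrt_smul_sacEstimator_sub (n : ℕ → Fin K → ℕ) (T : ℕ → Fin K → Ω → Param p₁ p₂)
    (φ : EuclideanSpace ℝ (Fin p₁)) (m : ℕ) (ω : Ω) :
    √(totalSize n m) • (sacEstimator n T m ω - φ) =
      √(totalSize n m) • ∑ k, ((n m k : ℝ) / totalSize n m) • (common (T m k ω) - φ) := by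
  by_cases hN : totalSize n m = 0
  · simp only [hN, Real.sqrt_zero, zero_smul]
  congr 1
  simp_rw [smul_sub, Finset.sum_sub_distrib, ← Finset.sum_smul, ← Finset.sum_div]
  rw [← Nat.cast_sum, div_self hN, one_smul, sacEstimator, Finset.smul_sum]
  simp_rw [smul_smul, inv_mul_eq_div]

variable [MeasurableSpace Ω] {P : Measure Ω} {X : Fin K → ℕ → Ω → Obs d}

theorem IsLocalEstimator.aemeasurable_sacEstimator (hT : IsLocalEstimator P M Θ X n T) (m : ℕ) :
    AEMeasurable (sacEstimator n T m) P :=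
  (Finset.aemeasurable_fun_sum Finset.univ fun k _ =>
    (measurable_common.comp_aemeasurable (hT.aemeasurable m k)).const_smul
      (n m k : ℝ)).const_smul (totalSize n m)⁻¹

theorem IsLocalEstimator.isArgminDisplacement (hT : IsLocalEstimator P M Θ X n T)
    (θ : Fin K → Param p₁ p₂) (m : ℕ) :
    ∀ᵐ ω ∂P, IsArgminDisplacement ⊤ Θ θ (fun k => empObj M (fun i => X k i ω) (n m k))
      fun k => T m k ω - θ k := by
  filter_upwards [ae_all_iff.2 (hT.argmin m)] with ω hω
  refine ⟨trivial, fun k => ?_, fun δ _ hδ => Finset.sum_le_sum fun k _ => ?_⟩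
  · simpa only [add_sub_cancel] using (hω k).1
  · simpa only [add_sub_cancel] using isMinOn_iff.1 (hω k).2 _ (hδ k)

theorem tendstoInDistribution_sac [IsProbabilityMeasure P] [∀ k, IsFiniteMeasure (F k)]
    (hB : ∀ k, RegularBlock (F k) M (Θ k) (join φs (ls k)) (G k) c r) (hn : SampleSizes n γ)
    (hX : IsSample P X F) (hT : IsLocalEstimator P M Θ X n T) :
    TendstoInDistribution (fun m ω => √(totalSize n m) • (sacEstimator n T m ω - φs)) atTop id
      (fun _ => P) (multivariateGaussian 0 (covSaC F M (fun k => join φs (ls k)) γ)) := by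
  have hJ := fun k => (hB k).posDef_partialHess
  refine tendstoInDistribution_of_argmin (q := fun m k => n m k / totalSize n m)
    (δ := fun m ω k => T m k ω - join φs (ls k))
    (u := fun v k => (partialHess (F k) M (join φs (ls k)))⁻¹.mulVec v) hB hn hX hn.ratio_tendsto
    (fun m k => (hT.aemeasurable m k).sub_const _) (hT.isArgminDisplacement _)
    (fun _ => trivial)
    (fun m => ((hT.aemeasurable_sacEstimator m).sub_const _).const_smul (√(totalSize n m)))
    (fun m ω v => ?_) (posSemidef_covSaC hB fun k => (hn.limit_pos k).le)
    fun v => dotProduct_covSaC_mulVec (fun k => (hJ k).isHermitian) v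
  simp_rw [sqrt_smul_sacEstimator_sub, real_inner_smul_left, sum_inner,
    mulVec_inv_mulVec (hJ _).isUnit, real_inner_smul_left, common_sub, common_join,
    EuclideanSpace.inner_eq_star_dotProduct, star_trivial, dotProduct_comm v.ofLp]

end SaCEstimator

/-! ### The full-sample estimator -/

section FullEstimator

theorem join_common (θ : Param p₁ p₂) :
    join (common θ) (WithLp.toLp 2 fun b => θ (Sum.inr b)) = θ := by
  ext (a | b) <;> rfl

theorem measurable_join :
    Measurable fun t : EuclideanSpace ℝ (Fin p₁) × EuclideanSpace ℝ (Fin p₂) => join t.1 t.2 := by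
  refine (WithLp.measurable_toLp 2 _).comp (measurable_pi_lambda _ fun a => ?_)
  cases a <;> simp only [Sum.elim_inl, Sum.elim_inr] <;> fun_prop

/-- The displacements of the block parameters that move the common component equally in all
blocks. -/
def commonSubmodule (p₁ p₂ K : ℕ) : Submodule ℝ (Fin K → Param p₁ p₂) where
  carrier := {δ | ∃ φ, ∀ k, common (δ k) = φ}
  add_mem' := by
    rintro δ δ' ⟨φ, hφ⟩ ⟨φ', hφ'⟩
    exact ⟨φ + φ', fun k => congrArg₂ (· + ·) (hφ k) (hφ' k)⟩
  zero_mem' := ⟨0, fun _ => rfl⟩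
  smul_mem' := by
    rintro t δ ⟨φ, hφ⟩
    exact ⟨t • φ, fun k => congrArg (t • ·) (hφ k)⟩

variable {Ω : Type*} [MeasurableSpace Ω] {P : Measure Ω} {X : Fin K → ℕ → Ω → Obs d}
  {F : Fin K → Measure (Obs d)} {M : Obs d → Param p₁ p₂ → ℝ} {Θ : Fin K → Set (Param p₁ p₂)}
  {θ : Fin K → Param p₁ p₂} {φs : EuclideanSpace ℝ (Fin p₁)}
  {ls : Fin K → EuclideanSpace ℝ (Fin p₂)} {n : ℕ → Fin K → ℕ} {γ : Fin K → ℝ}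
  {G : Fin K → Obs d → ℝ} {c r : ℝ}
  {T : ℕ → Ω → EuclideanSpace ℝ (Fin p₁) × (Fin K → EuclideanSpace ℝ (Fin p₂))}

theorem posDef_sum_smul_partialHess [∀ k, IsFiniteMeasure (F k)]
    (hB : ∀ k, RegularBlock (F k) M (Θ k) (θ k) (G k) c r) (hn : SampleSizes n γ) :
    (∑ k, γ k • partialHess (F k) M (θ k)).PosDef :=
  have := hn.nonempty
  Matrix.posDef_sum Finset.univ_nonempty fun k _ =>
    (hB k).posDef_partialHess.smul (hn.limit_pos k)

theorem posSemidef_covFull [∀ k, IsFiniteMeasure (F k)]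
    (hB : ∀ k, RegularBlock (F k) M (Θ k) (θ k) (G k) c r) (hγ : ∀ k, 0 ≤ γ k)
    (hJ : (∑ k, γ k • partialHess (F k) M (θ k)).IsHermitian) : (covFull F M θ γ).PosSemidef :=
  posSemidef_inv_mul_mul_inv hJ <| Matrix.posSemidef_sum _ fun k _ =>
    (hB k).posSemidef_scoreVar.smul (hγ k)

theorem dotProduct_covFull_mulVec
    (hJ : (∑ k, γ k • partialHess (F k) M (θ k)).IsHermitian) (v : Fin p₁ → ℝ) :
    v ⬝ᵥ (covFull F M θ γ).mulVec v =
      ∑ k, γ k * ((∑ k, γ k • partialHess (F k) M (θ k))⁻¹.mulVec v ⬝ᵥ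
        (scoreVar (F k) M (θ k)).mulVec ((∑ k, γ k • partialHess (F k) M (θ k))⁻¹.mulVec v)) := by
  rw [covFull, dotProduct_inv_mul_mul_inv_mulVec hJ]
  simp_rw [Matrix.sum_mulVec, dotProduct_sum, Matrix.smul_mulVec, dotProduct_smul, smul_eq_mul]

theorem IsFullEstimator.aemeasurable_block (hT : IsFullEstimator P M Θ X n T) (m : ℕ)
    (k : Fin K) : AEMeasurable (fun ω => join (T m ω).1 ((T m ω).2 k)) P :=
  measurable_join.comp_aemeasurable (f := fun ω => ((T m ω).1, (T m ω).2 k))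
    ((hT.aemeasurable m).fst.prodMk
      ((measurable_pi_apply k).comp_aemeasurable (hT.aemeasurable m).snd))

theorem IsFullEstimator.isArgminDisplacement (hT : IsFullEstimator P M Θ X n T)
    (φs : EuclideanSpace ℝ (Fin p₁)) (ls : Fin K → EuclideanSpace ℝ (Fin p₂)) (m : ℕ) :
    ∀ᵐ ω ∂P, IsArgminDisplacement (commonSubmodule p₁ p₂ K) Θ (fun k => join φs (ls k))
      (fun k => empObj M (fun i => X k i ω) (n m k))
      fun k => join (T m ω).1 ((T m ω).2 k) - join φs (ls k) := by
  filter_upwards [hT.argmin m] with ω hω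
  refine ⟨⟨(T m ω).1 - φs, fun _ => rfl⟩, fun k => ?_, ?_⟩
  · simpa only [add_sub_cancel] using hω.1 k
  rintro δ ⟨φ, hφ⟩ hδ
  have hjoin : ∀ k, join (φs + φ)
      (WithLp.toLp 2 fun b => (join φs (ls k) + δ k) (Sum.inr b)) = join φs (ls k) + δ k :=
    fun k => hφ k ▸ join_common (join φs (ls k) + δ k)
  have hmem : (φs + φ, fun k => WithLp.toLp 2 fun b => (join φs (ls k) + δ k) (Sum.inr b)) ∈
      fullSpace Θ := fun k => (hjoin k).symm ▸ hδ k
  simpa only [hjoin, add_sub_cancel] using isMinOn_iff.1 hω.2 _ hmem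

theorem tendstoInDistribution_full [IsProbabilityMeasure P] [∀ k, IsFiniteMeasure (F k)]
    (hB : ∀ k, RegularBlock (F k) M (Θ k) (join φs (ls k)) (G k) c r) (hn : SampleSizes n γ)
    (hX : IsSample P X F) (hT : IsFullEstimator P M Θ X n T) :
    TendstoInDistribution (fun m ω => √(totalSize n m) • ((T m ω).1 - φs)) atTop id
      (fun _ => P) (multivariateGaussian 0 (covFull F M (fun k => join φs (ls k)) γ)) := by
  have hJ := posDef_sum_smul_partialHess hB hn
  refine tendstoInDistribution_of_argmin (q := fun _ => γ)
    (δ := fun m ω k => join (T m ω).1 ((T m ω).2 k) - join φs (ls k))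
    (u := fun v _ => (∑ k, γ k • partialHess (F k) M (join φs (ls k)))⁻¹.mulVec v) hB hn hX
    (fun _ => tendsto_const_nhds) (fun m k => (hT.aemeasurable_block m k).sub_const _)
    (hT.isArgminDisplacement φs ls) (fun v => ⟨WithLp.toLp 2 (Matrix.mulVec _ v), fun _ => rfl⟩)
    (fun m => ((hT.aemeasurable m).fst.sub_const _).const_smul (√(totalSize n m)))
    (fun m ω v => ?_) (posSemidef_covFull hB (fun k => (hn.limit_pos k).le) hJ.isHermitian)
    fun v => dotProduct_covFull_mulVec hJ.isHermitian v
  simp_rw [real_inner_smul_left, common_sub, common_join, ← smul_eq_mul, ← dotProduct_smul,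
    ← Matrix.smul_mulVec, ← dotProduct_sum, ← Matrix.sum_mulVec, mulVec_inv_mulVec hJ.isUnit,
    EuclideanSpace.inner_eq_star_dotProduct, star_trivial, dotProduct_comm v.ofLp]

end FullEstimator

/-! ### Quadratic functions -/

section Quadratic

theorem hasGradientAt_quadratic {E : Type*} [NormedAddCommGroup E] [InnerProductSpace ℝ E]
    [CompleteSpace E] {A : E →L[ℝ] E} (hA : (A : E →ₗ[ℝ] E).IsSymmetric) {b : E} {k : ℝ}
    {f : E → ℝ} (hf : ∀ θ, f θ = ⟪A θ, θ⟫_ℝ / 2 - ⟪b, θ⟫_ℝ + k) (θ : E) :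
    HasGradientAt f (A θ - b) θ := by
  rw [funext hf, hasGradientAt_iff_hasFDerivAt]
  have hquad := ((A.hasFDerivAt (x := θ)).inner ℝ (hasFDerivAt_id θ)).mul_const (2⁻¹ : ℝ)
  have hlin := (innerSL ℝ b).hasFDerivAt (x := θ)
  refine ((hquad.sub hlin).add_const k).congr_fderiv (ContinuousLinearMap.ext fun u => ?_)
  have hsymm : ⟪A u, θ⟫_ℝ = ⟪A θ, u⟫_ℝ := (hA u θ).trans (real_inner_comm _ _)
  simp [hsymm]
  ring

variable {A : Matrix (Fin p₁ ⊕ Fin p₂) (Fin p₁ ⊕ Fin p₂) ℝ} {b : Param p₁ p₂} {k : ℝ}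
  {f : Param p₁ p₂ → ℝ}

theorem gradient_quadratic (hA : A.IsHermitian)
    (hf : ∀ θ, f θ = ⟪Matrix.toEuclideanCLM (𝕜 := ℝ) A θ, θ⟫_ℝ / 2 - ⟪b, θ⟫_ℝ + k) :
    gradient f = fun θ => Matrix.toEuclideanCLM (𝕜 := ℝ) A θ - b :=
  funext fun θ =>
    (hasGradientAt_quadratic (Matrix.isSymmetric_toEuclideanLin_iff.2 hA) hf θ).gradient

theorem twiceDifferentiableAt_quadratic (hA : A.IsHermitian)
    (hf : ∀ θ, f θ = ⟪Matrix.toEuclideanCLM (𝕜 := ℝ) A θ, θ⟫_ℝ / 2 - ⟪b, θ⟫_ℝ + k)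
    (θ : Param p₁ p₂) : TwiceDifferentiableAt f θ := by
  refine ⟨Eventually.of_forall fun η => (hasGradientAt_quadratic
    (Matrix.isSymmetric_toEuclideanLin_iff.2 hA) hf η).differentiableAt, ?_⟩
  rw [gradient_quadratic hA hf]
  fun_prop

theorem hess_quadratic (hA : A.IsHermitian)
    (hf : ∀ θ, f θ = ⟪Matrix.toEuclideanCLM (𝕜 := ℝ) A θ, θ⟫_ℝ / 2 - ⟪b, θ⟫_ℝ + k)
    (θ : Param p₁ p₂) : hess f θ = A := by
  have h := fderiv_gradient_eq_hess f θ
  rw [gradient_quadratic hA hf, fderiv_sub_const, ContinuousLinearMap.fderiv] at h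
  exact ((Matrix.toEuclideanCLM (𝕜 := ℝ)).injective h).symm

end Quadratic

section RankOne

theorem isHermitian_vecMulVec_self {ι : Type*} (u : ι → ℝ) :
    (Matrix.vecMulVec u u).IsHermitian := by
  rw [Matrix.IsHermitian, Matrix.conjTranspose_vecMulVec, star_trivial]

variable {ι : Type*} [Fintype ι] [DecidableEq ι] (u : EuclideanSpace ℝ ι)

theorem toEuclideanCLM_vecMulVec_self : Matrix.toEuclideanCLM (𝕜 := ℝ) (Matrix.vecMulVec u u) =
    InnerProductSpace.rankOne ℝ u u := by
  refine ContinuousLinearMap.ext fun w => PiLp.ext fun a => ?_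
  rw [Matrix.ofLp_toEuclideanCLM, Matrix.vecMulVec_mulVec]
  simp [EuclideanSpace.inner_eq_star_dotProduct, dotProduct_comm, mul_comm]

theorem norm_vecMulVec_self : ‖Matrix.vecMulVec u u‖ = ‖u‖ ^ 2 := by
  rw [← Matrix.l2_opNorm_toEuclideanCLM, toEuclideanCLM_vecMulVec_self,
    InnerProductSpace.norm_rankOne, sq]

end RankOne

/-! ### Least squares with blocks of different scales -/

/-- The regressor `(z, 1)` of the observation `x = (z, y)`, so that the common parameter is the
slope and the block parameter the intercept. -/
noncomputable def regressor (x : Obs 2) : Param 1 1 :=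
  WithLp.toLp 2 (Sum.elim (fun _ => x 0) fun _ => 1)

/-- The least squares loss `(y - z φ - λ)² / 2` of the observation `x = (z, y)`. -/
noncomputable def lsq (x : Obs 2) (θ : Param 1 1) : ℝ := (x 1 - ⟪regressor x, θ⟫_ℝ) ^ 2 / 2

/-- The distribution of `(z, y)` with `z` and `y` independent and uniform on `{c, -c}`; the
regression of `y` on `z` has slope and intercept `0`. -/
noncomputable def fourPoint (c : ℝ) : Measure (Obs 2) :=
  (4 : ENNReal)⁻¹ • (Measure.dirac !₂[c, c] + Measure.dirac !₂[c, -c] +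
    Measure.dirac !₂[-c, c] + Measure.dirac !₂[-c, -c])

theorem lintegral_fourPoint (c : ℝ) (f : Obs 2 → ENNReal) :
    ∫⁻ x, f x ∂fourPoint c = (4 : ENNReal)⁻¹ *
      (f !₂[c, c] + f !₂[c, -c] + f !₂[-c, c] + f !₂[-c, -c]) := by
  simp [fourPoint, lintegral_add_measure, mul_add]

theorem lintegral_fourPoint_lt_top (c : ℝ) {f : Obs 2 → ENNReal} (hf : ∀ x, f x < ⊤) :
    ∫⁻ x, f x ∂fourPoint c < ⊤ := by
  rw [lintegral_fourPoint]
  exact ENNReal.mul_lt_top (by simp) (by simp [ENNReal.add_lt_top, hf])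

instance isProbabilityMeasure_fourPoint (c : ℝ) : IsProbabilityMeasure (fourPoint c) where
  measure_univ := by
    have four_eq : (1 + 1 + 1 + 1 : ENNReal) = 4 := by norm_num
    rw [← lintegral_one, lintegral_fourPoint, four_eq]
    exact ENNReal.inv_mul_cancel (by norm_num) (by norm_num)

theorem integrable_fourPoint (c : ℝ) (f : Obs 2 → ℝ) : Integrable f (fourPoint c) := by
  have h : ∀ x : Obs 2, Integrable f (Measure.dirac x) := fun x => integrable_dirac (by simp)
  exact ((((h _).add_measure (h _)).add_measure (h _)).add_measure (h _)).smul_measure (by simp)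

theorem integral_fourPoint (c : ℝ) (f : Obs 2 → ℝ) :
    ∫ x, f x ∂fourPoint c = (f !₂[c, c] + f !₂[c, -c] + f !₂[-c, c] + f !₂[-c, -c]) / 4 := by
  have h : ∀ x : Obs 2, Integrable f (Measure.dirac x) := fun x => integrable_dirac (by simp)
  rw [fourPoint, integral_smul_measure, integral_add_measure
    (((h _).add_measure (h _)).add_measure (h _)) (h _), integral_add_measure
    ((h _).add_measure (h _)) (h _), integral_add_measure (h _) (h _)]
  simp only [integral_dirac, ENNReal.toReal_inv, ENNReal.toReal_ofNat, smul_eq_mul]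
  ring

theorem lsq_eq (x : Obs 2) (θ : Param 1 1) :
    lsq x θ = ⟪Matrix.toEuclideanCLM (𝕜 := ℝ)
      (Matrix.vecMulVec (regressor x) (regressor x)) θ, θ⟫_ℝ / 2
      - ⟪x 1 • regressor x, θ⟫_ℝ + x 1 ^ 2 / 2 := by
  rw [toEuclideanCLM_vecMulVec_self, InnerProductSpace.rankOne_apply, real_inner_smul_left,
    real_inner_smul_left, lsq]
  ring

theorem gradient_lsq (x : Obs 2) (θ : Param 1 1) :
    gradient (lsq x) θ = -(x 1 - ⟪regressor x, θ⟫_ℝ) • regressor x := by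
  simp only [gradient_quadratic (isHermitian_vecMulVec_self _) (lsq_eq x),
    toEuclideanCLM_vecMulVec_self, InnerProductSpace.rankOne_apply, ← sub_smul, neg_sub]

theorem hess_lsq (x : Obs 2) (θ : Param 1 1) :
    hess (lsq x) θ = Matrix.vecMulVec (regressor x) (regressor x) :=
  hess_quadratic (isHermitian_vecMulVec_self _) (lsq_eq x) θ

theorem gradOuter_lsq (x : Obs 2) (θ : Param 1 1) : gradOuter (lsq x) θ =
    (x 1 - ⟪regressor x, θ⟫_ℝ) ^ 2 • Matrix.vecMulVec (regressor x) (regressor x) := by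
  ext a b
  simp only [gradOuter, gradient_lsq, Matrix.of_apply, PiLp.smul_apply, smul_eq_mul,
    Matrix.smul_apply, Matrix.vecMulVec_apply]
  ring

theorem convexOn_lsq {S : Set (Param 1 1)} (hS : Convex ℝ S) (x : Obs 2) :
    ConvexOn ℝ S (lsq x) := by
  refine ⟨hS, fun θ _ η _ a b ha hb hab => ?_⟩
  obtain rfl : b = 1 - a := by linarith
  simp only [lsq, inner_add_right, real_inner_smul_right, smul_eq_mul]
  nlinarith [mul_nonneg (mul_nonneg ha hb)
    (sq_nonneg (⟪regressor x, θ⟫_ℝ - ⟪regressor x, η⟫_ℝ))]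

/-- A Lipschitz constant on the unit ball of the outer product of the gradient of `lsq x`. -/
noncomputable def outerLipschitz (x : Obs 2) : ℝ :=
  2 * (|x 1| + ‖regressor x‖) * ‖regressor x‖ ^ 3

theorem measurable_outerLipschitz : Measurable outerLipschitz := by
  have hreg : Continuous regressor := by
    refine (PiLp.continuous_toLp 2 _).comp (continuous_pi fun a => ?_)
    cases a <;> simp only [Sum.elim_inl, Sum.elim_inr] <;> fun_prop
  unfold outerLipschitz
  exact Continuous.measurable (by fun_prop)

theorem abs_residual_sq_sub_le (x : Obs 2) {θ η : Param 1 1} (hθ : ‖θ‖ ≤ 1) (hη : ‖η‖ ≤ 1) :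
    |(x 1 - ⟪regressor x, θ⟫_ℝ) ^ 2 - (x 1 - ⟪regressor x, η⟫_ℝ) ^ 2| ≤
      2 * (|x 1| + ‖regressor x‖) * (‖regressor x‖ * ‖θ - η‖) := by
  have abs_residual_le : ∀ u : Param 1 1, ‖u‖ ≤ 1 →
      |x 1 - ⟪regressor x, u⟫_ℝ| ≤ |x 1| + ‖regressor x‖ := fun u hu =>
    (abs_sub _ _).trans (add_le_add_right ((abs_real_inner_le_norm _ _).trans
      (mul_le_of_le_one_right (norm_nonneg _) hu)) _)
  have abs_add_le : |x 1 - ⟪regressor x, θ⟫_ℝ + (x 1 - ⟪regressor x, η⟫_ℝ)| ≤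
      2 * (|x 1| + ‖regressor x‖) := by
    linarith [abs_add_le (x 1 - ⟪regressor x, θ⟫_ℝ) (x 1 - ⟪regressor x, η⟫_ℝ),
      abs_residual_le θ hθ, abs_residual_le η hη]
  have abs_sub_le : |x 1 - ⟪regressor x, θ⟫_ℝ - (x 1 - ⟪regressor x, η⟫_ℝ)| ≤
      ‖regressor x‖ * ‖θ - η‖ := by
    rw [sub_sub_sub_cancel_left, ← inner_sub_right, norm_sub_rev θ η]
    exact abs_real_inner_le_norm _ _
  rw [sq_sub_sq, abs_mul]
  exact mul_le_mul abs_add_le abs_sub_le (abs_nonneg _) (by positivity)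

theorem norm_gradOuter_lsq_sub_le (x : Obs 2) {θ η : Param 1 1} (hθ : ‖θ‖ ≤ 1) (hη : ‖η‖ ≤ 1) :
    ‖gradOuter (lsq x) θ - gradOuter (lsq x) η‖ ≤ outerLipschitz x * ‖θ - η‖ := by
  rw [gradOuter_lsq, gradOuter_lsq, ← sub_smul, norm_smul, norm_vecMulVec_self, Real.norm_eq_abs]
  calc _ ≤ 2 * (|x 1| + ‖regressor x‖) * (‖regressor x‖ * ‖θ - η‖) * ‖regressor x‖ ^ 2 :=
        mul_le_mul_of_nonneg_right (abs_residual_sq_sub_le x hθ hη) (sq_nonneg _)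
    _ = _ := by rw [outerLipschitz]; ring

/-- The expected Hessian of `lsq` under `fourPoint c`. -/
noncomputable def riskHess (c : ℝ) : Matrix (Fin 1 ⊕ Fin 1) (Fin 1 ⊕ Fin 1) ℝ :=
  Matrix.diagonal (Sum.elim (fun _ => c ^ 2) fun _ => 1)

theorem isHermitian_riskHess (c : ℝ) : (riskHess c).IsHermitian :=
  Matrix.isHermitian_diagonal _

theorem inner_param_one_one (u w : Param 1 1) :
    ⟪u, w⟫_ℝ = u (Sum.inl 0) * w (Sum.inl 0) + u (Sum.inr 0) * w (Sum.inr 0) := by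
  simp [PiLp.inner_apply, mul_comm]

theorem popRisk_lsq (c : ℝ) (θ : Param 1 1) :
    popRisk (fourPoint c) lsq θ
      = (c ^ 2 + c ^ 2 * θ (Sum.inl 0) ^ 2 + θ (Sum.inr 0) ^ 2) / 2 := by
  simp only [popRisk, integral_fourPoint, lsq, inner_param_one_one, regressor, Sum.elim_inl,
    Sum.elim_inr, Matrix.cons_val_zero, Matrix.cons_val_one]
  ring

theorem popRisk_lsq_eq (c : ℝ) (θ : Param 1 1) :
    popRisk (fourPoint c) lsq θ = ⟪Matrix.toEuclideanCLM (𝕜 := ℝ) (riskHess c) θ, θ⟫_ℝ / 2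
      - ⟪(0 : Param 1 1), θ⟫_ℝ + c ^ 2 / 2 := by
  simp only [popRisk_lsq, inner_param_one_one, Matrix.ofLp_toEuclideanCLM, riskHess,
    Matrix.mulVec_diagonal, inner_zero_left, Sum.elim_inl, Sum.elim_inr]
  ring

theorem popHess_lsq (c : ℝ) (θ : Param 1 1) : popHess (fourPoint c) lsq θ = riskHess c := by
  ext a b
  simp only [popHess, Matrix.of_apply, integral_fourPoint, hess_lsq, Matrix.vecMulVec_apply,
    riskHess, regressor]
  rcases a with a | a <;> rcases b with b | b <;> simp [Matrix.diagonal, Subsingleton.elim a b] <;>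
    ring

theorem partialHess_lsq (c : ℝ) (θ : Param 1 1) :
    partialHess (fourPoint c) lsq θ = c ^ 2 • (1 : Matrix (Fin 1) (Fin 1) ℝ) := by
  rw [partialHess, popHess_lsq]
  ext a b
  simp [riskHess, Matrix.toBlocks₁₁, Matrix.toBlocks₁₂, Matrix.toBlocks₂₁, Matrix.toBlocks₂₂,
    Subsingleton.elim a b, Matrix.mul_apply]

theorem adjScore_lsq (c : ℝ) (x : Obs 2) (a : Fin 1) :
    adjScore (fourPoint c) lsq 0 x a = -(x 1 * x 0) := by
  rw [adjScore, popHess_lsq]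
  simp [riskHess, Matrix.toBlocks₁₂, gradient_lsq, regressor, Matrix.mulVec, dotProduct]

theorem scoreVar_lsq (c : ℝ) :
    scoreVar (fourPoint c) lsq 0 = c ^ 4 • (1 : Matrix (Fin 1) (Fin 1) ℝ) := by
  ext a b
  obtain rfl := Subsingleton.elim a b
  simp only [scoreVar, Matrix.of_apply, adjScore_lsq, covariance, integral_fourPoint,
    Matrix.smul_apply, Matrix.one_apply_eq, smul_eq_mul, Matrix.cons_val_zero, Matrix.cons_val_one]
  ring

/-! ### The least squares model -/

theorem identifiability_lsq {c : Fin K → ℝ} (hc : ∀ k, c k ≠ 0) (Θ : Fin K → Set (Param 1 1)) :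
    Identifiability lsq (fun k => fourPoint (c k)) Θ (fun _ => 0) where
  integrable k _ _ := integrable_fourPoint (c k) _
  unique_min k θ _ hθ := by
    have hpos : 0 < c k ^ 2 * θ (Sum.inl 0) ^ 2 + θ (Sum.inr 0) ^ 2 := by
      by_cases hslope : θ (Sum.inl 0) = 0
      · have hintercept : θ (Sum.inr 0) ≠ 0 := fun h => hθ <| by
          ext (a | a) <;> simp [Subsingleton.elim a 0, hslope, h]
        positivity
      · have := hc k
        positivity
    simp only [popRisk_lsq, PiLp.zero_apply]
    linarith

theorem compactness_closedBall (θs : Fin K → Param p₁ p₂) {r : ℝ} (hr : 0 < r) :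
    Compactness (fun k => Metric.closedBall (θs k) r) θs where
  compact _ := isCompact_closedBall _ _
  convex _ := convex_closedBall _ _
  interior _ := Metric.ball_subset_interior_closedBall (Metric.mem_ball_self hr)

theorem localStrongConvexity_lsq {c : Fin K → ℝ} (hc : ∀ k, 1 ≤ c k) (θs : Fin K → Param 1 1) :
    LocalStrongConvexity lsq (fun k => fourPoint (c k)) θs := by
  refine ⟨1, one_pos, fun k => ⟨twiceDifferentiableAt_quadratic (isHermitian_riskHess _)
    (popRisk_lsq_eq (c k)) _, ?_⟩⟩
  rw [hess_quadratic (isHermitian_riskHess _) (popRisk_lsq_eq (c k)), riskHess, one_smul,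
    ← Matrix.diagonal_one, Matrix.diagonal_sub]
  refine Matrix.PosSemidef.diagonal fun a => ?_
  rcases a with a | a
  · exact sub_nonneg.2 (one_le_pow₀ (hc k))
  · simp

theorem exists_pos_forall_le_ofReal_rpow {ι : Type*} [Finite ι] {a : ι → ENNReal}
    (ha : ∀ k, a k < ⊤) {q : ℝ} (hq : 1 ≤ q) :
    ∃ R : ℝ, 0 < R ∧ ∀ k, a k ≤ ENNReal.ofReal (R ^ q) := by
  cases nonempty_fintype ι
  have hsum : 0 ≤ ∑ k, (a k).toReal := Finset.sum_nonneg fun k _ => ENNReal.toReal_nonneg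
  refine ⟨1 + ∑ k, (a k).toReal, by positivity, fun k => ?_⟩
  rw [← ENNReal.ofReal_toReal (ha k).ne]
  refine ENNReal.ofReal_le_ofReal ?_
  calc (a k).toReal ≤ ∑ k, (a k).toReal :=
        Finset.single_le_sum (fun k _ => ENNReal.toReal_nonneg) (Finset.mem_univ k)
    _ ≤ (1 + ∑ k, (a k).toReal) ^ (1 : ℝ) := by rw [Real.rpow_one]; linarith
    _ ≤ (1 + ∑ k, (a k).toReal) ^ q := Real.rpow_le_rpow_of_exponent_le (by linarith) hq

theorem exists_moment_bound_fourPoint {H : Type*} [SeminormedAddCommGroup H] (c : Fin K → ℝ)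
    (f : Fin K → Obs 2 → H) {q : ℝ} (hq : 1 ≤ q) : ∃ R : ℝ, 0 < R ∧
      ∀ k, ∫⁻ x, ‖f k x‖ₑ ^ q ∂fourPoint (c k) ≤ ENNReal.ofReal (R ^ q) :=
  exists_pos_forall_le_ofReal_rpow (fun k => lintegral_fourPoint_lt_top (c k) fun _ =>
    ENNReal.rpow_lt_top_of_nonneg (by linarith) enorm_ne_top) hq

theorem smoothness_lsq (c : Fin K → ℝ) {v v₁ : ℝ} (hv : 1 ≤ v) (hv₁ : 1 ≤ v₁) :
    Smoothness lsq (fun k => fourPoint (c k)) (fun _ => 0) v v₁ := by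
  have hv' : 1 ≤ 2 * v := by linarith
  have hv₁' : 1 ≤ 2 * v₁ := by linarith
  obtain ⟨R, hR, score_le⟩ := exists_moment_bound_fourPoint c (fun _ x => gradient (lsq x) 0) hv₁'
  obtain ⟨L, hL, hess_le⟩ := exists_moment_bound_fourPoint c
    (fun k x => hess (lsq x) 0 - hess (popRisk (fourPoint (c k)) lsq) 0) hv'
  obtain ⟨B₀, hB₀, outer_le⟩ := exists_moment_bound_fourPoint c (fun _ => outerLipschitz) hv'
  refine ⟨R, L, 1, B₀, 1, fun _ => 0, outerLipschitz, hR, hL, one_pos, hB₀, one_pos,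
    measurable_const, measurable_outerLipschitz, fun k => ⟨fun x θ _ =>
      twiceDifferentiableAt_quadratic (isHermitian_vecMulVec_self _) (lsq_eq x) θ,
      score_le k, hess_le k, fun x θ hθ η hη => ⟨?_, ?_⟩, ?_, outer_le k⟩⟩
  · simp [hess_lsq]
  · rw [mem_closedBall_zero_iff] at hθ hη
    exact norm_gradOuter_lsq_sub_le x hθ hη
  · simp [ENNReal.zero_rpow_of_pos (show 0 < 2 * v by linarith)]

theorem join_zero : join (0 : EuclideanSpace ℝ (Fin p₁)) (0 : EuclideanSpace ℝ (Fin p₂)) = 0 := by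
  ext (a | b) <;> rfl

theorem model_lsq {c : Fin K → ℝ} (hc : ∀ k, 1 ≤ c k) {v v₁ : ℝ} (hv : 1 ≤ v) (hv₁ : 1 ≤ v₁) :
    Model lsq (fun k => fourPoint (c k)) (fun _ => Metric.closedBall 0 1) 0 (fun _ => 0) v v₁ where
  prob _ := inferInstance
  convex_obj _ x := convexOn_lsq (convex_closedBall _ _) x
  identifiability := by
    simpa only [join_zero] using identifiability_lsq (fun k => (one_pos.trans_le (hc k)).ne') _
  compactness := by simpa only [join_zero] using compactness_closedBall (fun _ => 0) one_pos
  strong_convexity := localStrongConvexity_lsq hc _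
  smoothness := by simpa only [join_zero] using smoothness_lsq c hv hv₁

theorem sampleSizes_balanced [NeZero K] :
    SampleSizes (K := K) (fun m _ => m) (fun _ => 1 / K) where
  total_tendsto := by
    simp only [Finset.sum_const, Finset.card_univ, Fintype.card_fin, smul_eq_mul]
    exact tendsto_id.const_mul_atTop' (NeZero.pos K)
  ratio_tendsto _ := by
    refine tendsto_const_nhds.congr' ?_
    filter_upwards [eventually_gt_atTop 0] with m hm
    have hm' : (m : ℝ) ≠ 0 := by positivity
    have hK : (K : ℝ) ≠ 0 := NeZero.ne _
    simp only [Finset.sum_const, Finset.card_univ, Fintype.card_fin, smul_eq_mul, Nat.cast_mul]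
    field_simp
  limit_pos _ := one_div_pos.2 (Nat.cast_pos.2 (NeZero.pos K))

/-- The scales of the two blocks of the least squares counterexample. -/
noncomputable def scale : Fin 2 → ℝ := ![1, 2]

theorem one_le_scale (k : Fin 2) : 1 ≤ scale k := by
  fin_cases k <;> norm_num [scale]

theorem inv_smul_one {ι : Type*} [Fintype ι] [DecidableEq ι] {a : ℝ} (ha : a ≠ 0) :
    (a • (1 : Matrix ι ι ℝ))⁻¹ = a⁻¹ • (1 : Matrix ι ι ℝ) :=
  Matrix.inv_eq_left_inv (by rw [Matrix.smul_mul, Matrix.mul_smul, Matrix.mul_one, smul_smul,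
    inv_mul_cancel₀ ha, one_smul])

theorem covSaC_lsq {c γ : Fin K → ℝ} (hc : ∀ k, c k ≠ 0) :
    covSaC (fun k => fourPoint (c k)) lsq (fun _ => 0) γ =
      (∑ k, γ k) • (1 : Matrix (Fin 1) (Fin 1) ℝ) := by
  simp only [covSaC, partialHess_lsq, scoreVar_lsq, inv_smul_one (pow_ne_zero 2 (hc _)),
    Matrix.mul_smul, Matrix.mul_one, smul_smul, ← Finset.sum_smul]
  congr 1
  refine Finset.sum_congr rfl fun k _ => ?_
  have := hc k
  field_simp

theorem covFull_lsq {c γ : Fin K → ℝ} (hc : ∑ k, γ k * c k ^ 2 ≠ 0) :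
    covFull (fun k => fourPoint (c k)) lsq (fun _ => 0) γ =
      ((∑ k, γ k * c k ^ 4) / (∑ k, γ k * c k ^ 2) ^ 2) • (1 : Matrix (Fin 1) (Fin 1) ℝ) := by
  simp only [covFull, partialHess_lsq, scoreVar_lsq, smul_smul, ← Finset.sum_smul,
    inv_smul_one hc, Matrix.mul_smul, Matrix.mul_one]
  congr 1
  field_simp

theorem not_posSemidef_covSaC_sub_covFull_lsq :
    ¬ (covSaC (fun k => fourPoint (scale k)) lsq (fun _ => 0) (fun _ => 1 / (2 : ℕ)) -
      covFull (fun k => fourPoint (scale k)) lsq (fun _ => 0)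
        (fun _ => 1 / (2 : ℕ))).PosSemidef := by
  have hSaC : covSaC (fun k => fourPoint (scale k)) lsq (fun _ => 0) (fun _ => 1 / (2 : ℕ)) =
      (1 : ℝ) • (1 : Matrix (Fin 1) (Fin 1) ℝ) := by
    rw [covSaC_lsq fun k => (one_pos.trans_le (one_le_scale k)).ne']
    norm_num
  have hFull : covFull (fun k => fourPoint (scale k)) lsq (fun _ => 0) (fun _ => 1 / (2 : ℕ)) =
      (34 / 25 : ℝ) • (1 : Matrix (Fin 1) (Fin 1) ℝ) := by
    rw [covFull_lsq] <;> norm_num [scale, Fin.sum_univ_two]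
  rw [hSaC, hFull, ← sub_smul]
  intro h
  have := h.diag_nonneg (i := 0)
  norm_num at this

theorem exists_model_not_posSemidef_covSaC_sub_covFull :
    ∃ (d p₁ p₂ K : ℕ) (M : Obs d → Param p₁ p₂ → ℝ) (F : Fin K → Measure (Obs d))
      (Θ : Fin K → Set (Param p₁ p₂)) (φs : EuclideanSpace ℝ (Fin p₁))
      (ls : Fin K → EuclideanSpace ℝ (Fin p₂)) (v v₁ : ℝ) (n : ℕ → Fin K → ℕ) (γ : Fin K → ℝ),
      0 < p₂ ∧ 2 ≤ v ∧ 2 ≤ v₁ ∧ Model M F Θ φs ls v v₁ ∧ SampleSizes n γ ∧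
      ¬ (covSaC F M (fun k => join φs (ls k)) γ -
          covFull F M (fun k => join φs (ls k)) γ).PosSemidef := by
  refine ⟨2, 1, 1, 2, lsq, fun k => fourPoint (scale k), fun _ => Metric.closedBall 0 1, 0,
    fun _ => 0, 2, 2, fun m _ => m, fun _ => 1 / (2 : ℕ), one_pos, le_rfl, le_rfl,
    model_lsq one_le_scale one_le_two one_le_two, sampleSizes_balanced, ?_⟩
  simpa only [join_zero] using not_posSemidef_covSaC_sub_covFull_lsq

end SaC

theorem mainTheorem6_general {d p₁ p₂ K : ℕ} {M : SaC.Obs d → SaC.Param p₁ p₂ → ℝ}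
    {F : Fin K → Measure (SaC.Obs d)} {Θ : Fin K → Set (SaC.Param p₁ p₂)}
    {φs : EuclideanSpace ℝ (Fin p₁)} {ls : Fin K → EuclideanSpace ℝ (Fin p₂)}
    {G : Fin K → SaC.Obs d → ℝ} {c r : ℝ} {n : ℕ → Fin K → ℕ} {γ : Fin K → ℝ}
    {Ω : Type*} [MeasurableSpace Ω] {P : Measure Ω} [IsProbabilityMeasure P]
    {X : Fin K → ℕ → Ω → SaC.Obs d} {Tloc : ℕ → Fin K → Ω → SaC.Param p₁ p₂}
    {Tfull : ℕ → Ω → EuclideanSpace ℝ (Fin p₁) × (Fin K → EuclideanSpace ℝ (Fin p₂))}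
    (hB : ∀ k, SaC.RegularBlock (F k) M (Θ k) (SaC.join φs (ls k)) (G k) c r)
    (hn : SaC.SampleSizes n γ) (hX : SaC.IsSample P X F)
    (hloc : SaC.IsLocalEstimator P M Θ X n Tloc) (hfull : SaC.IsFullEstimator P M Θ X n Tfull) :
    (∀ k, ((SaC.popHess (F k) M (SaC.join φs (ls k))).toBlocks₂₂).PosDef ∧
      (SaC.partialHess (F k) M (SaC.join φs (ls k))).PosDef) ∧
    TendstoInDistribution
      (fun m ω => √((∑ k, n m k : ℕ) : ℝ) • (SaC.sacEstimator n Tloc m ω - φs)) atTop id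
      (fun _ => P) (multivariateGaussian 0 (SaC.covSaC F M (fun k => SaC.join φs (ls k)) γ)) ∧
    TendstoInDistribution
      (fun m ω => √((∑ k, n m k : ℕ) : ℝ) • ((Tfull m ω).1 - φs)) atTop id
      (fun _ => P) (multivariateGaussian 0 (SaC.covFull F M (fun k => SaC.join φs (ls k)) γ)) := by
  have hF : ∀ k, IsProbabilityMeasure (F k) := fun k =>
    (hX.law k 0).isProbabilityMeasure_iff.1 inferInstance
  exact ⟨fun k => ⟨SaC.posDef_toBlocks₂₂ (hB k).posDef_popHess, (hB k).posDef_partialHess⟩,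
    SaC.tendstoInDistribution_sac hB hn hX hloc, SaC.tendstoInDistribution_full hB hn hX hfull⟩

theorem mainTheorem6 :
    -- asymptotic normality of both estimators
    (∀ (d p₁ p₂ K : ℕ) (M : SaC.Obs d → SaC.Param p₁ p₂ → ℝ) (F : Fin K → Measure (SaC.Obs d))
      (Θ : Fin K → Set (SaC.Param p₁ p₂)) (φs : EuclideanSpace ℝ (Fin p₁))
      (ls : Fin K → EuclideanSpace ℝ (Fin p₂)) (v v₁ : ℝ) (n : ℕ → Fin K → ℕ) (γ : Fin K → ℝ)
      (Ω : Type*) [MeasurableSpace Ω] (P : Measure Ω) [IsProbabilityMeasure P]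
      (X : Fin K → ℕ → Ω → SaC.Obs d) (Tloc : ℕ → Fin K → Ω → SaC.Param p₁ p₂)
      (Tfull : ℕ → Ω → EuclideanSpace ℝ (Fin p₁) × (Fin K → EuclideanSpace ℝ (Fin p₂))),
      2 ≤ v → 2 ≤ v₁ → SaC.Model M F Θ φs ls v v₁ → SaC.SampleSizes n γ →
      SaC.IsSample P X F → SaC.IsLocalEstimator P M Θ X n Tloc →
      SaC.IsFullEstimator P M Θ X n Tfull →
      (∀ k, ((SaC.popHess (F k) M (SaC.join φs (ls k))).toBlocks₂₂).PosDef ∧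
        (SaC.partialHess (F k) M (SaC.join φs (ls k))).PosDef) ∧
      TendstoInDistribution
        (fun m ω => √((∑ k, n m k : ℕ) : ℝ) • (SaC.sacEstimator n Tloc m ω - φs)) atTop id
        (fun _ => P) (multivariateGaussian 0 (SaC.covSaC F M (fun k => SaC.join φs (ls k)) γ)) ∧
      TendstoInDistribution
        (fun m ω => √((∑ k, n m k : ℕ) : ℝ) • ((Tfull m ω).1 - φs)) atTop id
        (fun _ => P) (multivariateGaussian 0 (SaC.covFull F M (fun k => SaC.join φs (ls k)) γ)))
    ∧
    -- the limiting covariance of the full-sample estimator need not be below that of SaC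
    (∃ (d p₁ p₂ K : ℕ) (M : SaC.Obs d → SaC.Param p₁ p₂ → ℝ) (F : Fin K → Measure (SaC.Obs d))
      (Θ : Fin K → Set (SaC.Param p₁ p₂)) (φs : EuclideanSpace ℝ (Fin p₁))
      (ls : Fin K → EuclideanSpace ℝ (Fin p₂)) (v v₁ : ℝ) (n : ℕ → Fin K → ℕ) (γ : Fin K → ℝ),
      0 < p₂ ∧ 2 ≤ v ∧ 2 ≤ v₁ ∧ SaC.Model M F Θ φs ls v v₁ ∧ SaC.SampleSizes n γ ∧
      ¬ (SaC.covSaC F M (fun k => SaC.join φs (ls k)) γ -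
          SaC.covFull F M (fun k => SaC.join φs (ls k)) γ).PosSemidef) := by
  refine ⟨fun d p₁ p₂ K M F Θ φs ls v v₁ n γ Ω _ P _ X Tloc Tfull hv hv₁ hM hn hX hloc hfull => ?_,
    SaC.exists_model_not_posSemidef_covSaC_sub_covFull⟩
  obtain ⟨G, c, r, hB⟩ := hM.exists_regularBlock hv hv₁
  exact mainTheorem6_general hB hn hX hloc hfull
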